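/- For a convex set $K\subseteq\mathbb R^n$ let $Cvx(K)$ be the set of all lower semicontinuous convex functions $f:K\to\mathbb R\cup\{+\infty\}$ together with the constant function $-\infty$, ordered pointwise; lower semicontinuity is with respect to the relative topology of $K$. For a family $\{f_\alpha\}\subseteq Cvx(K)$ let $\sup_\alpha f_\alpha\in Cvx(K)$ be its pointwise supremum and let $\hat{\inf}_\alpha f_\alpha:=\sup\{g\in Cvx(K): g\le f_\alpha\text{ for all }\alpha\}$. Write $epi(f)=\{(x,t)\in K\times\mathbb R: f(x)\le t\}$. A map $F$ from $D\subseteq\mathbb R^{m}$ to $\mathbb R^m$ is called fractional linear if $F(v)=\dfrac{Av+b}{\langle c,v\rangle+d}$ for all $v\in D$, where $A\in\mathbb R^{m\times m}$, $b,c\in\mathbb R^m$, $d\in\mathbb R$, the matrix $\begin{pmatrix}A&b\\c^T&d\end{pmatrix}$ is invertible, and $\langle c,v\rangle+d\ne0$ on $D$. Theorem 4.3. Let $n\ge1$, and let $K_1,K_2\subseteq\mathbb R^n$ be convex sets with nonempty interior. Let $T:Cvx(K_1)\to Cvx(K_2)$ be an injective (not necessarily surjective) map such that $$T\bigl(\sup_\alpha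 f_\alpha\bigr)=\sup_\alpha Tf_\alpha,\qquad T\bigl(\hat{\inf}_\alpha f_\alpha\bigr)=\hat{\inf}_\alpha Tf_\alpha$$ for every nonempty family $\{f_\alpha\}\subseteq Cvx(K_1)$. Then there exist $K_2'\subseteq K_2$ and a fractional linear map $F$ on $K_1\times\mathbb R\subseteq\mathbb R^{n+1}$ that is a bijection from $K_1\times\mathbb R$ onto $K_2'\times\mathbb R$, such that for every $f\in Cvx(K_1)$ other than the constant $-\infty$, $$epi(Tf)=F(epi(f)),$$ and in particular $(Tf)(x)=+\infty$ for $x\in K_2\setminus K_2'$; moreover $T(-\infty)=-\infty$. -/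

import Mathlib

/-- The epigraph of `f : K → [-∞, ∞]`, as a subset of `K × ℝ ⊆ E × ℝ`. -/
def epigraphOn {E : Type*} {K : Set E} (f : K → EReal) : Set (E × ℝ) :=
  {p | ∃ h : p.1 ∈ K, f ⟨p.1, h⟩ ≤ (p.2 : EReal)}

/-- `Cvx K`: the lower semicontinuous (for the topology of `K`) convex functions
`K → ℝ ∪ {+∞}`, together with the constant function `-∞` on `K`. -/
@[ext]
structure Cvx {E : Type*} [AddCommGroup E] [Module ℝ E] [TopologicalSpace E] (K : Set E) where
  toFun : K → EReal
  lowerSemicontinuous : LowerSemicontinuous toFun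
  convex_epi : Convex ℝ (epigraphOn toFun)
  ne_bot_or_eq_bot : (∀ x, toFun x ≠ ⊥) ∨ (∀ x, toFun x = ⊥)

namespace Cvx

variable {E : Type*} [AddCommGroup E] [Module ℝ E] [TopologicalSpace E] {K : Set E}

/-- The epigraph of a member of `Cvx K`. -/
def epi (f : Cvx K) : Set (E × ℝ) := epigraphOn f.toFun

/-- The pointwise order. -/
noncomputable instance : PartialOrder (Cvx K) :=
  PartialOrder.lift Cvx.toFun (fun _ _ h => Cvx.ext h)

/-- The pointwise supremum of a family of elements of `Cvx K`
(for the empty family it is the constant function `-∞`). -/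
noncomputable def sup (hK : Convex ℝ K) (S : Set (Cvx K)) : Cvx K where
  toFun x := ⨆ f ∈ S, f.toFun x
  lowerSemicontinuous :=
    lowerSemicontinuous_biSup fun f _ => f.lowerSemicontinuous
  convex_epi := by
    intro p hp q hq a b ha hb hab
    obtain ⟨hp1, hp2⟩ := hp
    obtain ⟨hq1, hq2⟩ := hq
    refine ⟨hK hp1 hq1 ha hb hab, iSup₂_le fun f hf => ?_⟩
    have h1 : p ∈ epigraphOn f.toFun :=
      ⟨hp1, le_trans (le_iSup₂ (f := fun (f : Cvx K) (_ : f ∈ S) => f.toFun ⟨p.1, hp1⟩) f hf) hp2⟩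
    have h2 : q ∈ epigraphOn f.toFun :=
      ⟨hq1, le_trans (le_iSup₂ (f := fun (f : Cvx K) (_ : f ∈ S) => f.toFun ⟨q.1, hq1⟩) f hf) hq2⟩
    exact (f.convex_epi h1 h2 ha hb hab).2
  ne_bot_or_eq_bot := by
    by_cases h : ∃ f ∈ S, ∀ x, f.toFun x ≠ ⊥
    · obtain ⟨f, hf, hx⟩ := h
      refine Or.inl fun x h0 => hx x ?_
      exact le_bot_iff.1 (le_trans
        (le_iSup₂ (f := fun (f : Cvx K) (_ : f ∈ S) => f.toFun x) f hf) h0.le)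
    · refine Or.inr fun x => le_bot_iff.1 (iSup₂_le fun f hf => ?_)
      rcases f.ne_bot_or_eq_bot with h1 | h1
      · exact absurd ⟨f, hf, h1⟩ h
      · exact (h1 x).le

/-- The generalized infimum: the supremum of all `g` in `Cvx K` lying below the family. -/
noncomputable def infHat (hK : Convex ℝ K) (S : Set (Cvx K)) : Cvx K :=
  sup hK {g | ∀ f ∈ S, g ≤ f}

/-- The constant function `-∞` on `K`. -/
noncomputable def negInf (hK : Convex ℝ K) : Cvx K where
  toFun _ := ⊥
  lowerSemicontinuous := lowerSemicontinuous_const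
  convex_epi := fun _ hp _ hq _ _ ha hb hab => ⟨hK hp.1 hq.1 ha hb hab, bot_le⟩
  ne_bot_or_eq_bot := Or.inr fun _ => rfl

end Cvx

/-- `F` is fractional linear on `D`: there is an invertible linear map `L` of `V × ℝ`, in block
form `L (v, t) = (A v + t b, c v + t d)`, such that for all `v ∈ D` the denominator `c v + d`
does not vanish and `F v = (A v + b) / (c v + d)`. -/
def IsFractionalLinearOn {V : Type*} [AddCommGroup V] [Module ℝ V] (F : V → V) (D : Set V) :
    Prop :=
  ∃ L : (V × ℝ) ≃ₗ[ℝ] (V × ℝ), ∀ v ∈ D,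
    (L (v, 1)).2 ≠ 0 ∧ F v = ((L (v, 1)).2)⁻¹ • (L (v, 1)).1

/-!
The proof works with epigraphs: `f ≤ g` iff `g.epi ⊆ f.epi`, suprema are intersections, and a
generalized infimum is a closed convex hull. An injective `T` commuting with suprema and
generalized infima is an order embedding.

The key point is that `T` maps a function `delta x c` that is finite at a single point to a function
of the same kind. Through `x` there is a flag of flats of dimensions `0, …, n` whose traces on `K₁`
strictly grow. With `φ` an affine functional vanishing on one flat and not on the next, the trace
`D` of the former lies in the closure of the union of the convex pieces `{φ ≥ 1 / (m + 1)}` of the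
trace of the latter, all disjoint from `D`. Translated by `T`, the image epigraph of `D` lies in the
closure of a set which meets it only inside the epigraph of `T (+∞)`; hence it cannot have full
dimension in the next image epigraph (`finrank_vectorSpan_lt_of_subset_closure`). So the dimension
grows at each of the `n` steps and ends at most at `n + 1`, which leaves dimension at most one for
`T (delta x c)`, and forces its epigraph to be a vertical ray.

Thus `T (delta x c) = delta (u x) (v x c)`, and `T (+∞) = +∞` since `u` is injective. The hull of
two such functions is a segment with everything above it, so `T` respects segments in `K₁ × ℝ`:
`v (x_s) ((1 - s) c + s d) = (1 - σ) v x c + σ v y d`, with `σ` independent of `c` and `d`. This is a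
Pexider equation with monotone solutions, so `v x c = a x * c + b x` with `a x > 0`, and comparing
coefficients shows that `1 / a`, `u / a` and `b / a` are affine on `K₁`. Their linear extensions to
homogeneous coordinates are the blocks of an invertible linear map, and `F (x, c) = (u x, v x c)`
is fractional linear.

Every `f ≠ -∞` is the generalized infimum of the functions `delta x c` with `(x, c)` in its
epigraph, so the epigraph of `T f` lies in the closure of `F '' f.epi`. Over `u '' K₁` it equals
`F '' f.epi` because `T` is an order embedding. Over a point `y` outside `u '' K₁` it is empty: the
restrictions of `f` to preimages of shrinking balls around `y` have supremum `+∞`, but their images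
agree with `T f` at `y`.
-/

open Module

/-! ### Epigraphs and members of `Cvx K` with a prescribed epigraph -/

namespace Cvx

section Basic

variable {E : Type*} [AddCommGroup E] [Module ℝ E] [TopologicalSpace E] {K : Set E}

theorem fst_mem_of_mem_epi {f : Cvx K} {p : E × ℝ} (hp : p ∈ f.epi) : p.1 ∈ K := hp.1

theorem mem_epi_of_le {f : Cvx K} {x : E} {s t : ℝ} (h : (x, s) ∈ f.epi) (hst : s ≤ t) :
    (x, t) ∈ f.epi :=
  ⟨h.1, h.2.trans (EReal.coe_le_coe_iff.2 hst)⟩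

theorem le_iff_epi_subset {f g : Cvx K} : f ≤ g ↔ g.epi ⊆ f.epi := by
  constructor
  · intro h p hp
    exact ⟨hp.1, (h ⟨p.1, hp.1⟩).trans hp.2⟩
  · intro h x
    refine EReal.le_of_forall_lt_iff_le.1 fun z hz => ?_
    exact (h (show ((x : E), z) ∈ g.epi from ⟨x.2, hz.le⟩)).2

theorem epi_injective : Function.Injective (epi : Cvx K → Set (E × ℝ)) := fun _ _ h =>
  le_antisymm (le_iff_epi_subset.2 h.ge) (le_iff_epi_subset.2 h.le)

theorem eq_of_epi_eq_empty {f g : Cvx K} (hf : f.epi = ∅) (hg : g.epi = ∅) : f = g :=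
  epi_injective (hf.trans hg.symm)

theorem toFun_eq_top_of_notMem {f : Cvx K} {x : K} (h : ∀ t : ℝ, ((x : E), t) ∉ f.epi) :
    f.toFun x = ⊤ :=
  EReal.eq_top_iff_forall_lt _ |>.2 fun t => not_le.1 fun ht => h t ⟨x.2, ht⟩

theorem eq_negInf_of_line {hK : Convex ℝ K} {f : Cvx K} {x : E} (hx : x ∈ K)
    (h : ∀ t : ℝ, (x, t) ∈ f.epi) : f = negInf hK := by
  have h0 : f.toFun ⟨x, hx⟩ = ⊥ := EReal.eq_bot_iff_forall_lt _ |>.2 fun t =>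
    lt_of_le_of_lt (h (t - 1)).2 (EReal.coe_lt_coe_iff.2 (by linarith))
  rcases f.ne_bot_or_eq_bot with h1 | h1
  · exact absurd h0 (h1 _)
  · ext y
    exact h1 y

theorem negInf_le (hK : Convex ℝ K) (f : Cvx K) : negInf hK ≤ f := fun _ => bot_le

theorem isLUB_sup (hK : Convex ℝ K) (S : Set (Cvx K)) : IsLUB S (sup hK S) := by
  constructor
  · intro f hf x
    exact le_iSup₂ (f := fun (f : Cvx K) (_ : f ∈ S) => f.toFun x) f hf
  · intro g hg x
    exact iSup₂_le fun f hf => hg hf x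

theorem isGLB_infHat (hK : Convex ℝ K) (S : Set (Cvx K)) : IsGLB S (infHat hK S) := by
  constructor
  · intro f hf
    exact (isLUB_sup hK _).2 fun g hg => hg f hf
  · intro g hg
    exact (isLUB_sup hK _).1 fun f hf => hg hf

theorem epi_sup (hK : Convex ℝ K) {S : Set (Cvx K)} (hS : S.Nonempty) :
    (sup hK S).epi = ⋂ f ∈ S, f.epi := by
  ext p
  simp only [Set.mem_iInter]
  constructor
  · intro hp f hf
    exact le_iff_epi_subset.1 ((isLUB_sup hK S).1 hf) hp
  · intro hp
    obtain ⟨f, hf⟩ := hS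
    exact ⟨(hp f hf).1, iSup₂_le fun g hg => (hp g hg).2⟩

end Basic

/-- The infimum of a closed, upward closed vertical section of `G` belongs to the section. -/
theorem iInf_coe_le_iff_mem {E : Type*} [NormedAddCommGroup E] {G : Set (E × ℝ)} {x : E} {t : ℝ}
    (hclosed : ∀ s : ℝ, (x, s) ∈ closure G → (x, s) ∈ G)
    (hup : ∀ s t, (x, s) ∈ G → s ≤ t → (x, t) ∈ G) :
    (⨅ (s : ℝ) (_ : (x, s) ∈ G), (s : EReal)) ≤ t ↔ (x, t) ∈ G := by
  constructor
  · intro h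
    refine hclosed _ ?_
    rw [mem_closure_iff_seq_limit]
    refine ⟨fun n => (x, t + 1 / ((n : ℝ) + 1)), fun n => ?_, ?_⟩
    · have hlt : (⨅ (s : ℝ) (_ : (x, s) ∈ G), (s : EReal)) <
          ((t + 1 / ((n : ℝ) + 1) : ℝ) : EReal) :=
        h.trans_lt (EReal.coe_lt_coe_iff.2 (by linarith [Nat.one_div_pos_of_nat (α := ℝ) (n := n)]))
      obtain ⟨s, hs⟩ := iInf_lt_iff.1 hlt
      obtain ⟨hs1, hs2⟩ := iInf_lt_iff.1 hs
      exact hup _ _ hs1 (EReal.coe_lt_coe_iff.1 hs2).le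
    · have h1 := tendsto_one_div_add_atTop_nhds_zero_nat (𝕜 := ℝ)
      have h2 := (tendsto_const_nhds (x := t)).add h1
      rw [add_zero] at h2
      exact tendsto_const_nhds.prodMk_nhds h2
  · intro h
    exact iInf₂_le (f := fun (s : ℝ) (_ : (x, s) ∈ G) => (s : EReal)) t h

section Normed

variable {E : Type*} [NormedAddCommGroup E] [NormedSpace ℝ E] {K : Set E}

theorem mem_epi_of_mem_closure {f : Cvx K} {p : E × ℝ} (hp : p ∈ closure f.epi)
    (hK : p.1 ∈ K) : p ∈ f.epi := by
  refine ⟨hK, EReal.le_of_forall_lt_iff_le.1 fun t ht => ?_⟩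
  by_contra hlt
  push Not at hlt
  have hev := f.lowerSemicontinuous ⟨p.1, hK⟩ t hlt
  rw [nhds_subtype_eq_comap, Filter.eventually_comap] at hev
  have h2 : ∀ᶠ q : E × ℝ in nhds p, q.2 < t :=
    continuous_snd.continuousAt.eventually_lt continuousAt_const (EReal.coe_lt_coe_iff.1 ht)
  obtain ⟨q, hq, h3, h4⟩ := (mem_closure_iff_frequently.1 hp).and_eventually
    ((continuous_fst.continuousAt.eventually hev).and h2) |>.exists
  have := h3 ⟨q.1, hq.1⟩ rfl
  exact absurd (hq.2.trans_lt (EReal.coe_lt_coe_iff.2 h4)) (not_lt.2 this.le)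

/-- A convex set `G` that is closed relative to `K × ℝ`, upward closed, and contains no vertical
line over a point of `K` is the epigraph of a member of `Cvx K`. `G` may stick out of `K × ℝ`;
only its part over `K` is used. -/
noncomputable def ofEpi (hK : Convex ℝ K) (G : Set (E × ℝ)) (hconv : Convex ℝ G)
    (hclosed : ∀ p ∈ closure G, p.1 ∈ K → p ∈ G)
    (hup : ∀ x s t, (x, s) ∈ G → s ≤ t → (x, t) ∈ G)
    (hline : ∀ x ∈ K, ∃ t : ℝ, (x, t) ∉ G) : Cvx K :=
  have key : ∀ (x : K) (t : ℝ),
      (⨅ (s : ℝ) (_ : ((x : E), s) ∈ G), (s : EReal)) ≤ t ↔ ((x : E), t) ∈ G := fun x _ =>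
    iInf_coe_le_iff_mem (fun _ hs => hclosed _ hs x.2) (hup x)
  { toFun := fun x => ⨅ (s : ℝ) (_ : ((x : E), s) ∈ G), (s : EReal)
    lowerSemicontinuous := by
      rw [lowerSemicontinuous_iff_isClosed_preimage]
      intro y
      induction y with
      | bot =>
        convert isClosed_empty
        ext x
        simp only [Set.mem_preimage, Set.mem_Iic, Set.mem_empty_iff_false, iff_false]
        intro h
        obtain ⟨t, ht⟩ := hline x x.2
        exact ht ((key x t).1 (h.trans bot_le))
      | top => simp
      | coe t =>
        refine isClosed_of_closure_subset fun x hx => ?_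
        refine (key x t).2 (hclosed _ ?_ x.2)
        have hcont : Continuous fun x : K => ((x : E), t) := by fun_prop
        exact map_mem_closure (f := fun x : K => ((x : E), t)) hcont hx fun z hz => (key z t).1 hz
    convex_epi := by
      intro p hp q hq a b ha hb hab
      exact ⟨hK hp.1 hq.1 ha hb hab, (key ⟨_, hK hp.1 hq.1 ha hb hab⟩ _).2
        (hconv ((key ⟨_, hp.1⟩ _).1 hp.2) ((key ⟨_, hq.1⟩ _).1 hq.2) ha hb hab)⟩
    ne_bot_or_eq_bot := by
      refine Or.inl fun x h => ?_
      obtain ⟨t, ht⟩ := hline x x.2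
      exact ht ((key x t).1 (h.le.trans bot_le)) }

theorem mem_epi_ofEpi {hK : Convex ℝ K} {G : Set (E × ℝ)} {hconv : Convex ℝ G}
    {hclosed : ∀ p ∈ closure G, p.1 ∈ K → p ∈ G}
    {hup : ∀ x s t, (x, s) ∈ G → s ≤ t → (x, t) ∈ G}
    {hline : ∀ x ∈ K, ∃ t : ℝ, (x, t) ∉ G} {p : E × ℝ} :
    p ∈ (ofEpi hK G hconv hclosed hup hline).epi ↔ p.1 ∈ K ∧ p ∈ G := by
  constructor
  · intro h
    exact ⟨h.1, (iInf_coe_le_iff_mem (fun _ hs => hclosed _ hs h.1) (hup p.1)).1 h.2⟩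
  · rintro ⟨h, hp⟩
    exact ⟨h, iInf₂_le (f := fun (s : ℝ) (_ : (p.1, s) ∈ G) => (s : EReal)) p.2 hp⟩

/-- If the epigraphs of a family have a convex union, the epigraph of the generalized infimum
lies in the closure of that union, unless the generalized infimum is `-∞`. -/
theorem epi_infHat_subset_closure (hK : Convex ℝ K) {S : Set (Cvx K)}
    (hne : infHat hK S ≠ negInf hK) (hconv : Convex ℝ (⋃ f ∈ S, f.epi)) :
    (infHat hK S).epi ⊆ closure (⋃ f ∈ S, f.epi) := by
  have hlow : ∀ p ∈ closure (⋃ f ∈ S, f.epi), p.1 ∈ K → p ∈ (infHat hK S).epi := by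
    intro p hp hpK
    refine mem_epi_of_mem_closure (closure_mono ?_ hp) hpK
    exact Set.iUnion₂_subset fun f hf => le_iff_epi_subset.1 ((isGLB_infHat hK S).1 hf)
  let g : Cvx K := ofEpi hK (closure (⋃ f ∈ S, f.epi)) hconv.closure
    (fun p hp _ => by rwa [closure_closure] at hp)
    (by
      intro x s t hs hst
      have hcont : Continuous fun p : E × ℝ => (p.1, p.2 + (t - s)) := by fun_prop
      have := map_mem_closure (t := ⋃ f ∈ S, f.epi) hcont hs (by
        intro p hp
        simp only [Set.mem_iUnion] at hp ⊢
        obtain ⟨f, hf, hp⟩ := hp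
        exact ⟨f, hf, mem_epi_of_le (s := p.2) hp (by linarith)⟩)
      simpa using this)
    (by
      intro x hx
      by_contra hcon
      push Not at hcon
      exact hne (eq_negInf_of_line hx fun t => hlow _ (hcon t) hx))
  have hg : g ≤ infHat hK S := by
    refine (isGLB_infHat hK S).2 fun f hf => le_iff_epi_subset.2 fun p hp => ?_
    exact mem_epi_ofEpi.2 ⟨hp.1, subset_closure (Set.mem_biUnion hf hp)⟩
  exact fun p hp => (mem_epi_ofEpi.1 (le_iff_epi_subset.1 hg hp)).2

/-- The function equal to `c` on `K ∩ C` and to `+∞` on the rest of `K`. -/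
noncomputable def box (hK : Convex ℝ K) (C : Set E) (hC : Convex ℝ C) (hC' : IsClosed C)
    (c : ℝ) : Cvx K :=
  ofEpi hK (C ×ˢ Set.Ici c) (hC.prod (convex_Ici c))
    (fun p hp _ => by rwa [(hC'.prod isClosed_Ici).closure_eq] at hp)
    (fun _ _ _ h hst => ⟨h.1, le_trans h.2 hst⟩)
    (fun _ _ => ⟨c - 1, fun h => by have := h.2; simp at this; linarith⟩)

theorem mem_epi_box {hK : Convex ℝ K} {C : Set E} {hC : Convex ℝ C} {hC' : IsClosed C}
    {c : ℝ} {p : E × ℝ} : p ∈ (box hK C hC hC' c).epi ↔ p.1 ∈ K ∧ p.1 ∈ C ∧ c ≤ p.2 :=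
  mem_epi_ofEpi

/-- The function equal to `c` at `x` and to `+∞` elsewhere. -/
noncomputable def delta (hK : Convex ℝ K) (x : E) (c : ℝ) : Cvx K :=
  box hK {x} (convex_singleton x) isClosed_singleton c

theorem mem_epi_delta {hK : Convex ℝ K} {x : E} {c : ℝ} {p : E × ℝ} :
    p ∈ (delta hK x c).epi ↔ p.1 ∈ K ∧ p.1 = x ∧ c ≤ p.2 :=
  mem_epi_box

/-- The constant function `+∞`. -/
noncomputable def posInf (hK : Convex ℝ K) : Cvx K :=
  box hK ∅ convex_empty isClosed_empty 0

theorem epi_posInf (hK : Convex ℝ K) : (posInf hK).epi = ∅ := by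
  ext p
  simp [posInf, mem_epi_box]

theorem le_delta_iff {hK : Convex ℝ K} {f : Cvx K} {x : E} (hx : x ∈ K) {c : ℝ} :
    f ≤ delta hK x c ↔ (x, c) ∈ f.epi := by
  rw [le_iff_epi_subset]
  constructor
  · exact fun h => h (mem_epi_delta.2 ⟨hx, rfl, le_rfl⟩)
  · rintro h ⟨y, t⟩ hp
    obtain ⟨-, h1, h2⟩ := mem_epi_delta.1 hp
    simp only at h1 h2
    subst h1
    exact mem_epi_of_le h h2

theorem isGLB_deltas {hK : Convex ℝ K} (f : Cvx K) :
    IsGLB ((fun p : E × ℝ => delta hK p.1 p.2) '' f.epi) f := by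
  constructor
  · rintro _ ⟨p, hp, rfl⟩
    exact (le_delta_iff hp.1).2 hp
  · intro g hg
    exact le_iff_epi_subset.2 fun p hp => (le_delta_iff hp.1).1 (hg ⟨p, hp, rfl⟩)

end Normed

end Cvx

/-! ### A dimension inequality for convex sets -/

/-- A criterion for a strict inequality of dimensions: if `A ⊆ B` is convex and lies in the closure
of a set `H ⊆ B` which meets `A` only inside a relatively closed set `N` not containing `A`, then `A`
cannot have full dimension in `B`. Otherwise `A` would have interior points relative to the affine
span of `B`, and `H` would be dense in this relative interior. -/
theorem finrank_vectorSpan_lt_of_subset_closure {X : Type*} [NormedAddCommGroup X]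
    [NormedSpace ℝ X] [FiniteDimensional ℝ X] {A B H N : Set X} (hA : Convex ℝ A)
    (hAB : A ⊆ B) (hHB : H ⊆ B) (hAH : A ⊆ closure H) (hN : A ∩ H ⊆ N)
    (hcl : A ∩ closure N ⊆ N) (hAN : ¬ A ⊆ N) :
    Module.finrank ℝ (vectorSpan ℝ A) < Module.finrank ℝ (vectorSpan ℝ B) := by
  by_contra hlt
  have hle : vectorSpan ℝ A ≤ vectorSpan ℝ B := vectorSpan_mono ℝ hAB
  have heq : vectorSpan ℝ A = vectorSpan ℝ B :=
    Submodule.eq_of_le_of_finrank_le hle (not_lt.1 hlt)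
  apply hAN
  obtain ⟨a₀, ha₀, -⟩ := Set.not_subset.1 hAN
  let W := vectorSpan ℝ A
  let ψ : W → X := fun w => (w : X) + a₀
  have hψ : Topology.IsInducing ψ :=
    (Homeomorph.addRight a₀).isInducing.comp Topology.IsInducing.subtypeVal
  have hrange : ∀ b ∈ B, ∃ w, ψ w = b := by
    intro b hb
    refine ⟨⟨b - a₀, ?_⟩, by simp [ψ]⟩
    change b - a₀ ∈ vectorSpan ℝ A
    rw [heq]
    exact vsub_mem_vectorSpan ℝ hb (hAB ha₀)
  let A' : Set W := ψ ⁻¹' A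
  have hA' : Convex ℝ A' := by
    intro v hv w hw a b ha hb hab
    have := hA hv hw ha hb hab
    change ((a • v + b • w : W) : X) + a₀ ∈ A
    convert this using 1
    simp only [ψ, Submodule.coe_add, Submodule.coe_smul, smul_add]
    rw [add_add_add_comm, ← add_smul, hab, one_smul]
  have h0 : (0 : W) ∈ A' := by simpa [A', ψ] using ha₀
  have hspan : affineSpan ℝ A' = ⊤ := by
    rw [AffineSubspace.affineSpan_eq_top_iff_vectorSpan_eq_top_of_nonempty ℝ W W ⟨0, h0⟩]
    rw [eq_top_iff]
    have hmap : (vectorSpan ℝ A').map W.subtype = W := by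
      apply le_antisymm (Submodule.map_subtype_le _ _)
      change vectorSpan ℝ A ≤ _
      rw [vectorSpan_eq_span_vsub_set_right ℝ ha₀, Submodule.span_le]
      rintro _ ⟨a, ha, rfl⟩
      obtain ⟨w, hw⟩ := hrange a (hAB ha)
      refine ⟨w, ?_, by simp [← hw, ψ]⟩
      have hwA : w ∈ A' := by simpa [A', hw] using ha
      simpa using vsub_mem_vectorSpan ℝ hwA h0
    intro w _
    have hw : (w : X) ∈ (vectorSpan ℝ A').map W.subtype := by rw [hmap]; exact w.2
    obtain ⟨w', hw', h⟩ := hw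
    rwa [← Subtype.ext h]
  have hint : (interior A').Nonempty := hA'.interior_nonempty_iff_affineSpan_eq_top.2 hspan
  have hsub : interior A' ⊆ A' := interior_subset
  have h1 : interior A' ⊆ closure (ψ ⁻¹' N) := by
    intro w hw
    have hwH : w ∈ closure (ψ ⁻¹' H) := by
      rw [hψ.closure_eq_preimage_closure_image, Set.mem_preimage]
      refine closure_mono ?_ (hAH (hsub hw))
      intro h hh
      obtain ⟨v, rfl⟩ := hrange h (hHB hh)
      exact ⟨v, hh, rfl⟩
    refine closure_mono ?_ (isOpen_interior.inter_closure ⟨hw, hwH⟩)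
    exact fun v hv => hN ⟨hsub hv.1, hv.2⟩
  intro a ha
  obtain ⟨w, rfl⟩ := hrange a (hAB ha)
  refine hcl ⟨ha, ?_⟩
  have h2 : w ∈ closure (interior A') := by
    rw [hA'.closure_interior_eq_closure_of_nonempty_interior hint]
    exact subset_closure ha
  have h3 : w ∈ closure (ψ ⁻¹' N) := closure_minimal h1 isClosed_closure h2
  exact map_mem_closure hψ.continuous h3 fun v hv => hv

/-! ### Embeddings and the dimension of image epigraphs -/

/-- A basis of `E` consisting of differences with `x₀` of points of a convex body. -/
theorem exists_basis_add_mem {E : Type*} [NormedAddCommGroup E] [NormedSpace ℝ E]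
    [FiniteDimensional ℝ E] {K : Set E} (hint : (interior K).Nonempty)
    {x₀ : E} (hx₀ : x₀ ∈ K) :
    ∃ b : Basis (Fin (finrank ℝ E)) ℝ E, ∀ i, x₀ + b i ∈ K := by
  have hspan : Submodule.span ℝ ((· -ᵥ x₀) '' K) = ⊤ := by
    rw [← vectorSpan_eq_span_vsub_set_right ℝ hx₀, ← direction_affineSpan,
      affineSpan_eq_top_of_nonempty_interior
        (hint.mono (interior_mono (subset_convexHull ℝ K))), AffineSubspace.direction_top]
  obtain ⟨f, hf, hfs, hli⟩ := Submodule.exists_fun_fin_finrank_span_eq ℝ ((· -ᵥ x₀) '' K)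
  have hcard : finrank ℝ (Submodule.span ℝ ((· -ᵥ x₀) '' K)) = finrank ℝ E := by
    rw [hspan, finrank_top]
  refine ⟨(Basis.mk hli (hfs.trans hspan).ge).reindex (finCongr hcard), fun i => ?_⟩
  obtain ⟨y, hy, hyi⟩ := hf ((finCongr hcard).symm i)
  rw [Basis.reindex_apply, Basis.mk_apply, ← hyi]
  simpa using hy

/-- An injective map between spaces `Cvx K` that commutes with the suprema and generalized infima
of nonempty families. -/
structure IsSupInfEmbedding {E : Type*} [AddCommGroup E] [Module ℝ E] [TopologicalSpace E]
    {K₁ K₂ : Set E} (hK₁ : Convex ℝ K₁) (hK₂ : Convex ℝ K₂) (T : Cvx K₁ → Cvx K₂) : Prop where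
  injective : Function.Injective T
  map_sup : ∀ S : Set (Cvx K₁), S.Nonempty → T (Cvx.sup hK₁ S) = Cvx.sup hK₂ (T '' S)
  map_infHat : ∀ S : Set (Cvx K₁), S.Nonempty →
    T (Cvx.infHat hK₁ S) = Cvx.infHat hK₂ (T '' S)

namespace IsSupInfEmbedding

open Cvx

section Order

variable {E : Type*} [AddCommGroup E] [Module ℝ E] [TopologicalSpace E] {K₁ K₂ : Set E}
  {hK₁ : Convex ℝ K₁} {hK₂ : Convex ℝ K₂} {T : Cvx K₁ → Cvx K₂}

theorem map_isLUB (hT : IsSupInfEmbedding hK₁ hK₂ T) {S : Set (Cvx K₁)} (hS : S.Nonempty)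
    {f : Cvx K₁} (hf : IsLUB S f) : IsLUB (T '' S) (T f) := by
  rw [hf.unique (isLUB_sup hK₁ S), hT.map_sup S hS]
  exact isLUB_sup hK₂ _

theorem map_isGLB (hT : IsSupInfEmbedding hK₁ hK₂ T) {S : Set (Cvx K₁)} (hS : S.Nonempty)
    {f : Cvx K₁} (hf : IsGLB S f) : IsGLB (T '' S) (T f) := by
  rw [hf.unique (isGLB_infHat hK₁ S), hT.map_infHat S hS]
  exact isGLB_infHat hK₂ _

theorem le_iff (hT : IsSupInfEmbedding hK₁ hK₂ T) {f g : Cvx K₁} : T f ≤ T g ↔ f ≤ g := by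
  have h0 := isLUB_sup hK₁ {f, g}
  have h := hT.map_isLUB (Set.insert_nonempty _ _) h0
  rw [Set.image_pair] at h
  constructor
  · intro hfg
    have h1 : T (sup hK₁ {f, g}) = T g :=
      le_antisymm (h.2 (by simp [upperBounds, hfg])) (h.1 (by simp))
    rw [← hT.injective h1]
    exact h0.1 (by simp)
  · intro hfg
    have h1 : sup hK₁ {f, g} = g :=
      le_antisymm (h0.2 (by simp [upperBounds, hfg])) (h0.1 (by simp))
    rw [← h1]
    exact h.1 (by simp)

theorem epi_subset_iff (hT : IsSupInfEmbedding hK₁ hK₂ T) {f g : Cvx K₁} :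
    (T f).epi ⊆ (T g).epi ↔ f.epi ⊆ g.epi := by
  rw [← le_iff_epi_subset, ← le_iff_epi_subset, hT.le_iff]

theorem map_ne_negInf (hT : IsSupInfEmbedding hK₁ hK₂ T) {f : Cvx K₁} (hf : f ≠ negInf hK₁) :
    T f ≠ negInf hK₂ := by
  intro h
  apply hf
  refine le_antisymm (hT.le_iff.1 ?_) (negInf_le hK₁ f)
  rw [h]
  exact negInf_le hK₂ _

theorem epi_map_of_epi_eq_biInter (hT : IsSupInfEmbedding hK₁ hK₂ T) {S : Set (Cvx K₁)}
    (hS : S.Nonempty) {f : Cvx K₁} (hf : f.epi = ⋂ g ∈ S, g.epi) :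
    (T f).epi = ⋂ g ∈ S, (T g).epi := by
  have h : f = sup hK₁ S := epi_injective (hf.trans (epi_sup hK₁ hS).symm)
  rw [h, hT.map_sup S hS, epi_sup hK₂ (hS.image T), Set.biInter_image]

theorem epi_map_of_epi_eq_inter (hT : IsSupInfEmbedding hK₁ hK₂ T) {f g h : Cvx K₁}
    (hf : f.epi = g.epi ∩ h.epi) : (T f).epi = (T g).epi ∩ (T h).epi := by
  have := hT.epi_map_of_epi_eq_biInter (S := {g, h}) (Set.insert_nonempty _ _) (f := f)
    (by rw [hf, Set.biInter_pair])
  rw [this, Set.biInter_pair]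

end Order

section FiniteDimensional

variable {E : Type*} [NormedAddCommGroup E] [NormedSpace ℝ E] [FiniteDimensional ℝ E]
  {K₁ K₂ : Set E} {hK₁ : Convex ℝ K₁} {hK₂ : Convex ℝ K₂} {T : Cvx K₁ → Cvx K₂}

/-- Adding one point `p` off a slice `{φ = 0}` of `C` strictly raises the dimension of the image
epigraph: the slice is the limit of the disjoint pieces `{φ ≥ 1 / (m + 1)}` of `C`. -/
theorem finrank_vectorSpan_epi_lt (hT : IsSupInfEmbedding hK₁ hK₂ T) {C D : Set E}
    (hC : Convex ℝ C) (hC' : IsClosed C) (hD : Convex ℝ D) (hD' : IsClosed D)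
    (hDC : D ⊆ C) (φ : E →ᵃ[ℝ] ℝ) (hφD : ∀ x ∈ D, φ x = 0) {p x₀ : E} (hp : p ∈ K₁)
    (hpC : p ∈ C) (hφp : φ p = 1) (hx₀ : x₀ ∈ K₁) (hx₀D : x₀ ∈ D) (c : ℝ) :
    finrank ℝ (vectorSpan ℝ (T (box hK₁ D hD hD' c)).epi) <
      finrank ℝ (vectorSpan ℝ (T (box hK₁ C hC hC' c)).epi) := by
  have hφ : Continuous φ := φ.continuous_of_finiteDimensional
  let S : ℕ → Set E := fun m => C ∩ φ ⁻¹' Set.Ici (1 / ((m : ℝ) + 1))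
  have hS : ∀ m, Convex ℝ (S m) := fun m => hC.inter ((convex_Ici _).affine_preimage φ)
  have hS' : ∀ m, IsClosed (S m) := fun m => hC'.inter (isClosed_Ici.preimage hφ)
  let h : ℕ → Cvx K₁ := fun m => box hK₁ (S m) (hS m) (hS' m) c
  have hmono : Monotone fun m => (T (h m)).epi := by
    intro m k hmk
    refine hT.epi_subset_iff.2 fun q hq => ?_
    obtain ⟨h1, h2, h3⟩ := mem_epi_box.1 hq
    have h4 : 1 / ((m : ℝ) + 1) ≤ φ q.1 := h2.2
    exact mem_epi_box.2 ⟨h1, ⟨h2.1, (Nat.one_div_le_one_div hmk).trans h4⟩, h3⟩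
  refine finrank_vectorSpan_lt_of_subset_closure (H := ⋃ m, (T (h m)).epi)
    (N := (T (posInf hK₁)).epi) (T _).convex_epi ?_ ?_ ?_ ?_ ?_ ?_
  · refine hT.epi_subset_iff.2 fun q hq => ?_
    obtain ⟨h1, h2, h3⟩ := mem_epi_box.1 hq
    exact mem_epi_box.2 ⟨h1, hDC h2, h3⟩
  · refine Set.iUnion_subset fun m => hT.epi_subset_iff.2 fun q hq => ?_
    obtain ⟨h1, h2, h3⟩ := mem_epi_box.1 hq
    exact mem_epi_box.2 ⟨h1, h2.1, h3⟩
  · have hne : infHat hK₁ (Set.range h) ≠ negInf hK₁ := by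
      intro h0
      have hle : box hK₁ Set.univ convex_univ isClosed_univ c ≤ infHat hK₁ (Set.range h) := by
        refine (isGLB_infHat hK₁ _).2 ?_
        rintro _ ⟨m, rfl⟩
        refine le_iff_epi_subset.2 fun q hq => ?_
        obtain ⟨h1, h2, h3⟩ := mem_epi_box.1 hq
        exact mem_epi_box.2 ⟨h1, trivial, h3⟩
      rw [h0, le_iff_epi_subset] at hle
      have hmem := hle (show (x₀, c - 1) ∈ (negInf hK₁).epi from ⟨hx₀, bot_le⟩)
      obtain ⟨-, -, h3⟩ := mem_epi_box.1 hmem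
      simp only at h3
      linarith
    have hle : infHat hK₁ (Set.range h) ≤ box hK₁ D hD hD' c := by
      rw [le_iff_epi_subset]
      rintro ⟨x, t⟩ hq
      obtain ⟨h1, h2, h3⟩ := mem_epi_box.1 hq
      refine mem_epi_of_mem_closure ?_ h1
      have hlim : Filter.Tendsto (fun m : ℕ => (AffineMap.lineMap x p (1 / ((m : ℝ) + 1)), t))
          Filter.atTop (nhds (x, t)) := by
        refine Filter.Tendsto.prodMk_nhds ?_ tendsto_const_nhds
        have hc : Continuous fun r : ℝ => AffineMap.lineMap x p r :=
          AffineMap.lineMap_continuous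
        have := (hc.tendsto 0).comp (tendsto_one_div_add_atTop_nhds_zero_nat (𝕜 := ℝ))
        rw [AffineMap.lineMap_apply_zero] at this
        exact this
      refine mem_closure_of_tendsto hlim (Filter.Eventually.of_forall fun m => ?_)
      have hm : 1 / ((m : ℝ) + 1) ∈ Set.Icc (0 : ℝ) 1 :=
        ⟨Nat.one_div_pos_of_nat.le, by
          rw [div_le_one (by positivity)]; linarith [(Nat.cast_nonneg m : (0 : ℝ) ≤ m)]⟩
      refine le_iff_epi_subset.1 ((isGLB_infHat hK₁ (Set.range h)).1 ⟨m, rfl⟩)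
        (mem_epi_box.2 (⟨?_, ⟨?_, ?_⟩, h3⟩ : _ ∧ _ ∈ S m ∧ _))
      · exact hK₁.lineMap_mem h1 hp hm
      · exact hC.lineMap_mem (hDC h2) hpC hm
      · change 1 / ((m : ℝ) + 1) ≤ φ (AffineMap.lineMap x p (1 / ((m : ℝ) + 1)))
        rw [AffineMap.apply_lineMap, hφD x h2, hφp]
        simp [AffineMap.lineMap_apply]
    have hT' := hT.map_ne_negInf hne
    rw [hT.map_infHat _ (Set.range_nonempty h), ← Set.range_comp] at hT'
    have hunion : ⋃ f ∈ Set.range (T ∘ h), f.epi = ⋃ m, (T (h m)).epi := Set.biUnion_range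
    have := epi_infHat_subset_closure hK₂ hT' (by
      rw [hunion]
      exact (directed_of_isDirected_le hmono).convex_iUnion fun m => (T (h m)).convex_epi)
    rw [hunion, Set.range_comp, ← hT.map_infHat _ (Set.range_nonempty h)] at this
    exact (hT.epi_subset_iff.2 (le_iff_epi_subset.1 hle)).trans this
  · rw [Set.inter_iUnion]
    refine Set.iUnion_subset fun m => ?_
    rw [← hT.epi_map_of_epi_eq_inter (f := posInf hK₁)]
    rw [epi_posInf, eq_comm, Set.eq_empty_iff_forall_notMem]
    rintro q ⟨hq1, hq2⟩
    have h1 := hφD _ (mem_epi_box.1 hq1).2.1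
    have h2 : 1 / ((m : ℝ) + 1) ≤ φ q.1 := (mem_epi_box.1 hq2).2.1.2
    rw [h1] at h2
    exact absurd h2 (not_le.2 Nat.one_div_pos_of_nat)
  · exact fun q hq => mem_epi_of_mem_closure hq.2 hq.1.1
  · rw [hT.epi_subset_iff, epi_posInf]
    intro h0
    exact h0 (mem_epi_box.2 ⟨hx₀, hx₀D, le_rfl⟩ : (x₀, c) ∈ _)

/-- The image of a function that is finite at a single point has an epigraph of dimension at most
one: the dimensions of the image epigraphs strictly increase along a flag of flats through `x₀`
with `finrank ℝ E` steps, and they cannot exceed `finrank ℝ E + 1`. -/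
theorem finrank_vectorSpan_epi_delta_le (hT : IsSupInfEmbedding hK₁ hK₂ T)
    (hint : (interior K₁).Nonempty) {x₀ : E} (hx₀ : x₀ ∈ K₁) (c : ℝ) :
    finrank ℝ (vectorSpan ℝ (T (delta hK₁ x₀ c)).epi) ≤ 1 := by
  obtain ⟨b, hb⟩ := exists_basis_add_mem hint hx₀
  let φ : Fin (finrank ℝ E) → E →ᵃ[ℝ] ℝ := fun i =>
    (b.coord i).toAffineMap.comp (AffineMap.id ℝ E - AffineMap.const ℝ E x₀)
  have hφ : ∀ i x, φ i x = b.coord i (x - x₀) := fun i x => rfl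
  -- The flag of flats through `x₀` spanned by the first `k` basis vectors.
  let C : ℕ → Set E := fun k => ⋂ (i : Fin (finrank ℝ E)) (_ : k ≤ (i : ℕ)), φ i ⁻¹' {0}
  have hmem : ∀ k x, x ∈ C k ↔ ∀ i : Fin (finrank ℝ E), k ≤ (i : ℕ) → φ i x = 0 := by
    intro k x
    simp [C]
  have hC : ∀ k, Convex ℝ (C k) := fun k =>
    convex_iInter₂ fun i _ => (convex_singleton 0).affine_preimage (φ i)
  have hC' : ∀ k, IsClosed (C k) := fun k => isClosed_iInter fun i => isClosed_iInter fun _ =>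
    isClosed_singleton.preimage (φ i).continuous_of_finiteDimensional
  have hlt : ∀ k < finrank ℝ E,
      finrank ℝ (vectorSpan ℝ (T (box hK₁ (C k) (hC k) (hC' k) c)).epi) <
        finrank ℝ (vectorSpan ℝ (T (box hK₁ (C (k + 1)) (hC (k + 1)) (hC' (k + 1)) c)).epi) := by
    intro k hk
    refine hT.finrank_vectorSpan_epi_lt (hC _) (hC' _) (hC _) (hC' _) ?_ (φ ⟨k, hk⟩) ?_
      (p := x₀ + b ⟨k, hk⟩) (hb _) ?_ ?_ hx₀ ?_ c
    · intro x hx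
      rw [hmem] at hx ⊢
      exact fun i hi => hx i (by omega)
    · intro x hx
      exact (hmem k x).1 hx _ le_rfl
    · rw [hmem]
      intro i hi
      have hne : (⟨k, hk⟩ : Fin (finrank ℝ E)) ≠ i := by
        intro h
        rw [← h] at hi
        simp at hi
      simp [hφ, hne]
    · simp [hφ]
    · rw [hmem]
      intro i _
      simp [hφ]
  have hadd : ∀ k ≤ finrank ℝ E,
      finrank ℝ (vectorSpan ℝ (T (box hK₁ (C 0) (hC 0) (hC' 0) c)).epi) + k ≤
        finrank ℝ (vectorSpan ℝ (T (box hK₁ (C k) (hC k) (hC' k) c)).epi) := by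
    intro k
    induction k with
    | zero => simp
    | succ k ih =>
      intro hk
      have h1 := ih (by omega)
      have h2 := hlt k (by omega)
      omega
  have hC0 : delta hK₁ x₀ c = box hK₁ (C 0) (hC 0) (hC' 0) c := by
    apply epi_injective
    ext q
    rw [mem_epi_delta, mem_epi_box]
    have : q.1 = x₀ ↔ q.1 ∈ C 0 := by
      rw [hmem]
      constructor
      · rintro h i -
        simp [hφ, h]
      · intro h
        rw [← sub_eq_zero]
        refine b.ext_elem fun i => ?_
        simpa [hφ] using h i (Nat.zero_le _)
    rw [this]
  have h1 := hadd _ le_rfl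
  have h2 := Submodule.finrank_le
    (vectorSpan ℝ (T (box hK₁ (C (finrank ℝ E)) (hC _) (hC' _) c)).epi)
  rw [Module.finrank_prod, Module.finrank_self] at h2
  rw [hC0]
  omega

end FiniteDimensional

end IsSupInfEmbedding

/-! ### Functions with one-dimensional epigraph and hulls of two points -/

namespace Cvx

variable {E : Type*} [NormedAddCommGroup E] [NormedSpace ℝ E] {K : Set E}

theorem delta_le_delta_iff {hK : Convex ℝ K} {x y : E} {c d : ℝ} (hy : y ∈ K) :
    delta hK x c ≤ delta hK y d ↔ y = x ∧ c ≤ d := by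
  rw [le_delta_iff hy, mem_epi_delta]
  exact ⟨fun h => h.2, fun h => ⟨hy, h⟩⟩

theorem delta_ne_negInf {hK : Convex ℝ K} {x : E} {c : ℝ} (hx : x ∈ K) :
    delta hK x c ≠ negInf hK := by
  intro h
  have hmem : (x, c - 1) ∈ (delta hK x c).epi := by
    rw [h]
    exact ⟨hx, bot_le⟩
  have := (mem_epi_delta.1 hmem).2.2
  simp only at this
  linarith

/-- A member of `Cvx K` whose epigraph is one-dimensional is finite at a single point. -/
theorem exists_eq_delta {hK : Convex ℝ K} [FiniteDimensional ℝ E] {f : Cvx K}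
    (hf : f ≠ negInf hK) (hne : f.epi.Nonempty) (hdim : finrank ℝ (vectorSpan ℝ f.epi) ≤ 1) :
    ∃ y ∈ K, ∃ v, f = delta hK y v := by
  obtain ⟨⟨y, s⟩, hy, hs⟩ := hne
  simp only at hy hs
  have hbot : f.toFun ⟨y, hy⟩ ≠ ⊥ := by
    rcases f.ne_bot_or_eq_bot with h | h
    · exact h _
    · exact absurd (Cvx.ext (funext h)) hf
  have htop : f.toFun ⟨y, hy⟩ ≠ ⊤ := (hs.trans_lt (EReal.coe_lt_top s)).ne
  have hv : ((f.toFun ⟨y, hy⟩).toReal : EReal) = f.toFun ⟨y, hy⟩ := EReal.coe_toReal htop hbot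
  refine ⟨y, hy, (f.toFun ⟨y, hy⟩).toReal, epi_injective ?_⟩
  have hval : ∀ t : ℝ, (y, t) ∈ f.epi ↔ (f.toFun ⟨y, hy⟩).toReal ≤ t := by
    intro t
    rw [← EReal.coe_le_coe_iff, hv]
    exact ⟨fun h => h.2, fun h => ⟨hy, h⟩⟩
  ext ⟨z, t⟩
  rw [mem_epi_delta]
  constructor
  · intro hz
    have hzy : z = y := by
      obtain ⟨w, hw⟩ := finrank_le_one_iff.1 hdim
      have hs' : (y, s) ∈ f.epi := ⟨hy, hs⟩
      have h1 := vsub_mem_vectorSpan ℝ (mem_epi_of_le hs' (le_add_of_nonneg_right zero_le_one)) hs'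
      have h2 := vsub_mem_vectorSpan ℝ hz hs'
      obtain ⟨a, ha⟩ := hw ⟨_, h1⟩
      obtain ⟨a', ha'⟩ := hw ⟨_, h2⟩
      rw [Subtype.ext_iff, Prod.ext_iff] at ha ha'
      simp at ha ha'
      have ha0 : a ≠ 0 := by
        rintro rfl
        simp at ha
      have hw0 : (w : E × ℝ).1 = 0 := ha.1.resolve_left ha0
      rw [hw0, smul_zero] at ha'
      exact (sub_eq_zero.1 ha'.1.symm)
    subst hzy
    exact ⟨hy, rfl, (hval t).1 hz⟩
  · rintro ⟨-, rfl, h⟩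
    exact (hval t).2 h

open scoped Pointwise in
/-- The greatest member of `Cvx K` passing below two given points of `K × ℝ`: its epigraph is the
segment between them together with everything above it. -/
noncomputable def hull (hK : Convex ℝ K) (p q : E × ℝ) : Cvx K :=
  ofEpi hK (segment ℝ p q + {0} ×ˢ Set.Ici 0)
    ((convex_segment p q).add ((convex_singleton 0).prod (convex_Ici 0)))
    (fun r hr _ => by
      have hc : IsCompact (segment ℝ p q) := by
        rw [segment_eq_image_lineMap]
        exact isCompact_Icc.image AffineMap.lineMap_continuous
      rwa [((isClosed_singleton.prod isClosed_Ici).add_left_of_isCompact hc).closure_eq] at hr)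
    (by
      rintro x s t ⟨a, ha, b, ⟨hb1, hb2⟩, hab⟩ hst
      refine ⟨a, ha, (b.1, b.2 + (t - s)), ⟨hb1, ?_⟩, ?_⟩
      · simp only [Set.mem_Ici] at hb2 ⊢
        linarith
      · rw [Prod.ext_iff] at hab ⊢
        simp only [Prod.fst_add, Prod.snd_add] at hab ⊢
        exact ⟨hab.1, by linarith [hab.2]⟩)
    (by
      rintro x -
      refine ⟨min p.2 q.2 - 1, ?_⟩
      rintro ⟨a, ha, b, ⟨-, hb2⟩, hab⟩
      have h1 : min p.2 q.2 ≤ a.2 := by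
        obtain ⟨α, β, hα, hβ, hαβ, rfl⟩ := ha
        have := mul_le_mul_of_nonneg_left (min_le_left p.2 q.2) hα
        have := mul_le_mul_of_nonneg_left (min_le_right p.2 q.2) hβ
        have hm : min p.2 q.2 = α * min p.2 q.2 + β * min p.2 q.2 := by
          rw [← add_mul, hαβ, one_mul]
        simp only [Prod.snd_add, Prod.smul_snd, smul_eq_mul]
        linarith
      have h2 := congrArg Prod.snd hab
      simp only [Prod.snd_add, Set.mem_Ici] at h2 hb2
      linarith)

open scoped Pointwise in
theorem mem_epi_hull {hK : Convex ℝ K} {p q r : E × ℝ} (hp : p.1 ∈ K) (hq : q.1 ∈ K) :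
    r ∈ (hull hK p q).epi ↔ ∃ θ ∈ Set.Icc (0 : ℝ) 1,
      r.1 = AffineMap.lineMap p.1 q.1 θ ∧ AffineMap.lineMap p.2 q.2 θ ≤ r.2 := by
  rw [hull, mem_epi_ofEpi, segment_eq_image_lineMap]
  constructor
  · rintro ⟨-, _, ⟨θ, hθ, rfl⟩, b, ⟨hb1, hb2⟩, rfl⟩
    simp only [Set.mem_singleton_iff, Set.mem_Ici] at hb1 hb2
    refine ⟨θ, hθ, ?_, ?_⟩
    · simp [hb1, AffineMap.lineMap_apply]
    · simpa [AffineMap.lineMap_apply] using hb2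
  · rintro ⟨θ, hθ, h1, h2⟩
    refine ⟨h1 ▸ hK.lineMap_mem hp hq hθ, _, ⟨θ, hθ, rfl⟩,
      (0, r.2 - AffineMap.lineMap p.2 q.2 θ), ⟨rfl, sub_nonneg.2 h2⟩, ?_⟩
    rw [Prod.ext_iff]
    constructor
    · simp [h1, AffineMap.lineMap_apply]
    · simp [AffineMap.lineMap_apply]

theorem isGLB_hull {hK : Convex ℝ K} {p q : E × ℝ} (hp : p.1 ∈ K) (hq : q.1 ∈ K) :
    IsGLB {delta hK p.1 p.2, delta hK q.1 q.2} (hull hK p q) := by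
  constructor
  · rintro f (rfl | rfl)
    · exact (le_delta_iff hp).2 ((mem_epi_hull hp hq).2 ⟨0, by simp⟩)
    · exact (le_delta_iff hq).2 ((mem_epi_hull hp hq).2 ⟨1, by simp⟩)
  · intro g hg
    rw [le_iff_epi_subset]
    rintro ⟨x, t⟩ hr
    obtain ⟨θ, hθ, h1, h2⟩ := (mem_epi_hull hp hq).1 hr
    have hgp : p ∈ g.epi := (le_delta_iff (hK := hK) hp).1 (hg (by simp))
    have hgq : q ∈ g.epi := (le_delta_iff (hK := hK) hq).1 (hg (by simp))
    have hmem := g.convex_epi.lineMap_mem hgp hgq hθ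
    have heq : AffineMap.lineMap p q θ =
        (AffineMap.lineMap p.1 q.1 θ, AffineMap.lineMap p.2 q.2 θ) := by
      simp [AffineMap.lineMap_apply, Prod.ext_iff]
    rw [heq] at hmem
    simp only at h1 h2
    rw [h1]
    exact mem_epi_of_le hmem h2

end Cvx

/-! ### The induced map on points -/

namespace IsSupInfEmbedding

open Cvx

variable {E : Type*} [NormedAddCommGroup E] [NormedSpace ℝ E]
  {K₁ K₂ : Set E} {hK₁ : Convex ℝ K₁} {hK₂ : Convex ℝ K₂} {T : Cvx K₁ → Cvx K₂}

theorem exists_map_delta_eq [FiniteDimensional ℝ E] (hT : IsSupInfEmbedding hK₁ hK₂ T)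
    (hint : (interior K₁).Nonempty) {x : E} (hx : x ∈ K₁) (c : ℝ) :
    ∃ y ∈ K₂, ∃ v, T (delta hK₁ x c) = delta hK₂ y v := by
  refine exists_eq_delta (hT.map_ne_negInf (delta_ne_negInf hx)) ?_
    (hT.finrank_vectorSpan_epi_delta_le hint hx c)
  by_contra hcon
  rw [Set.not_nonempty_iff_eq_empty] at hcon
  have h := (hT.epi_subset_iff (f := delta hK₁ x c) (g := posInf hK₁)).1
    (by rw [hcon]; exact Set.empty_subset _)
  rw [epi_posInf] at h
  exact h (mem_epi_delta.2 ⟨hx, rfl, le_rfl⟩ : (x, c) ∈ _)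

/-- The map `(x, c) ↦ (u x, v x c)` describes the action of `T` on the functions that are finite
at a single point. -/
structure IsPointMap (hK₁ : Convex ℝ K₁) (hK₂ : Convex ℝ K₂) (T : Cvx K₁ → Cvx K₂)
    (u : E → E) (v : E → ℝ → ℝ) : Prop where
  mem : ∀ x ∈ K₁, u x ∈ K₂
  map_delta : ∀ x ∈ K₁, ∀ c, T (delta hK₁ x c) = delta hK₂ (u x) (v x c)

theorem exists_isPointMap [FiniteDimensional ℝ E] (hT : IsSupInfEmbedding hK₁ hK₂ T)
    (hint : (interior K₁).Nonempty) :
    ∃ u v, IsPointMap hK₁ hK₂ T u v := by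
  have h : ∀ (x : E) (c : ℝ), ∃ y v, x ∈ K₁ → y ∈ K₂ ∧ T (delta hK₁ x c) = delta hK₂ y v := by
    intro x c
    by_cases hx : x ∈ K₁
    · obtain ⟨y, hy, v, hv⟩ := hT.exists_map_delta_eq hint hx c
      exact ⟨y, v, fun _ => ⟨hy, hv⟩⟩
    · exact ⟨0, 0, fun h => absurd h hx⟩
  choose y v hyv using h
  refine ⟨fun x => y x 0, v, fun x hx => (hyv x 0 hx).1, fun x hx c => ?_⟩
  -- The functions `delta x c` with `x` fixed are comparable, so their images sit over one point.
  have hy : y x c = y x 0 := by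
    rcases le_total c 0 with hc | hc
    · have := hT.le_iff.2 ((delta_le_delta_iff (hK := hK₁) hx).2 ⟨rfl, hc⟩)
      rw [(hyv x c hx).2, (hyv x 0 hx).2, delta_le_delta_iff (hyv x 0 hx).1] at this
      exact this.1.symm
    · have := hT.le_iff.2 ((delta_le_delta_iff (hK := hK₁) hx).2 ⟨rfl, hc⟩)
      rw [(hyv x c hx).2, (hyv x 0 hx).2, delta_le_delta_iff (hyv x c hx).1] at this
      exact this.1
  rw [(hyv x c hx).2, hy]

namespace IsPointMap

variable {u : E → E} {v : E → ℝ → ℝ}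

theorem delta_le_iff (hT : IsSupInfEmbedding hK₁ hK₂ T) (h : IsPointMap hK₁ hK₂ T u v)
    {x y : E} (hx : x ∈ K₁) (hy : y ∈ K₁) {c d : ℝ} :
    u y = u x ∧ v x c ≤ v y d ↔ y = x ∧ c ≤ d := by
  rw [← delta_le_delta_iff (hK := hK₂) (h.mem y hy), ← h.map_delta x hx, ← h.map_delta y hy,
    hT.le_iff, delta_le_delta_iff hy]

theorem injOn (hT : IsSupInfEmbedding hK₁ hK₂ T) (h : IsPointMap hK₁ hK₂ T u v) :
    Set.InjOn u K₁ := by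
  intro x hx y hy hxy
  rcases le_total (v x 0) (v y 0) with hv | hv
  · exact ((h.delta_le_iff hT hx hy).1 ⟨hxy.symm, hv⟩).1.symm
  · exact ((h.delta_le_iff hT hy hx).1 ⟨hxy, hv⟩).1

theorem strictMono (hT : IsSupInfEmbedding hK₁ hK₂ T) (h : IsPointMap hK₁ hK₂ T u v)
    {x : E} (hx : x ∈ K₁) : StrictMono (v x) := by
  intro c d hcd
  by_contra hlt
  exact absurd ((h.delta_le_iff hT hx hx).1 ⟨rfl, not_lt.1 hlt⟩).2 (not_le.2 hcd)

theorem mem_epi_map_iff (hT : IsSupInfEmbedding hK₁ hK₂ T) (h : IsPointMap hK₁ hK₂ T u v)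
    {f : Cvx K₁} {x : E} (hx : x ∈ K₁) {c : ℝ} :
    (u x, v x c) ∈ (T f).epi ↔ (x, c) ∈ f.epi := by
  rw [← le_delta_iff (hK := hK₂) (h.mem x hx), ← h.map_delta x hx, hT.le_iff, le_delta_iff hx]

theorem epi_map_posInf (hT : IsSupInfEmbedding hK₁ hK₂ T) (h : IsPointMap hK₁ hK₂ T u v)
    (hK : K₁.Nontrivial) : (T (posInf hK₁)).epi = ∅ := by
  obtain ⟨x, hx, y, hy, hxy⟩ := hK
  rw [Set.eq_empty_iff_forall_notMem]
  intro q hq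
  have key : ∀ z ∈ K₁, q.1 = u z := by
    intro z hz
    have hsub : (T (posInf hK₁)).epi ⊆ (T (delta hK₁ z 0)).epi := by
      rw [hT.epi_subset_iff, epi_posInf]
      exact Set.empty_subset _
    have := hsub hq
    rw [h.map_delta z hz] at this
    exact (mem_epi_delta.1 this).2.1
  exact hxy (h.injOn hT hx hy ((key x hx).symm.trans (key y hy)))

/-- `u` maps a segment into a segment, and the point map sends every segment of `K₁ × ℝ` over it to
the segment between the images of the endpoints. The parameter `σ` does not depend on the
heights `c` and `d`. -/
theorem exists_lineMap_eq (hT : IsSupInfEmbedding hK₁ hK₂ T) (h : IsPointMap hK₁ hK₂ T u v)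
    {x y : E} (hx : x ∈ K₁) (hy : y ∈ K₁) (hxy : x ≠ y) {s : ℝ} (hs : s ∈ Set.Icc (0 : ℝ) 1) :
    ∃ σ ∈ Set.Icc (0 : ℝ) 1, u (AffineMap.lineMap x y s) = AffineMap.lineMap (u x) (u y) σ ∧
      ∀ c d, v (AffineMap.lineMap x y s) (AffineMap.lineMap c d s) =
        AffineMap.lineMap (v x c) (v y d) σ := by
  have hz : AffineMap.lineMap x y s ∈ K₁ := hK₁.lineMap_mem hx hy hs
  have key : ∀ c d, ∃ σ ∈ Set.Icc (0 : ℝ) 1,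
      u (AffineMap.lineMap x y s) = AffineMap.lineMap (u x) (u y) σ ∧
      v (AffineMap.lineMap x y s) (AffineMap.lineMap c d s) =
        AffineMap.lineMap (v x c) (v y d) σ := by
    intro c d
    have hG := hT.map_isGLB (Set.insert_nonempty _ _)
      (isGLB_hull (hK := hK₁) (p := (x, c)) (q := (y, d)) hx hy)
    rw [Set.image_pair, h.map_delta x hx, h.map_delta y hy] at hG
    have hTh : T (hull hK₁ (x, c) (y, d)) = hull hK₂ (u x, v x c) (u y, v y d) :=
      hG.unique (isGLB_hull (p := (u x, v x c)) (q := (u y, v y d)) (h.mem x hx) (h.mem y hy))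
    have h1 : (AffineMap.lineMap x y s, AffineMap.lineMap c d s) ∈
        (hull hK₁ (x, c) (y, d)).epi := (mem_epi_hull hx hy).2 ⟨s, hs, rfl, le_rfl⟩
    rw [← h.mem_epi_map_iff hT hz, hTh, mem_epi_hull (h.mem x hx) (h.mem y hy)] at h1
    obtain ⟨σ, hσ, h2, h3⟩ := h1
    refine ⟨σ, hσ, h2, le_antisymm ?_ h3⟩
    -- Cutting the hull by a slightly lower ray gives the original ray, so there is no room between
    -- the two segments.
    by_contra hlt
    push Not at hlt
    have hcut : (delta hK₁ (AffineMap.lineMap x y s) (AffineMap.lineMap c d s)).epi =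
        (hull hK₁ (x, c) (y, d)).epi ∩
          (delta hK₁ (AffineMap.lineMap x y s) (AffineMap.lineMap c d s - 1)).epi := by
      ext ⟨z, t⟩
      rw [Set.mem_inter_iff, mem_epi_delta, mem_epi_delta, mem_epi_hull hx hy]
      constructor
      · rintro ⟨hzK, hz1, hz2⟩
        simp only at hz1 hz2
        exact ⟨⟨s, hs, hz1, hz2⟩, hzK, hz1, by simp only; linarith⟩
      · rintro ⟨⟨θ, -, hθ1, hθ2⟩, hzK, hz1, -⟩
        simp only at hθ1 hθ2 hz1
        have : θ = s := AffineMap.lineMap_injective ℝ hxy (hθ1.symm.trans hz1)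
        subst this
        exact ⟨hzK, hz1, hθ2⟩
    have hcut' := hT.epi_map_of_epi_eq_inter hcut
    rw [h.map_delta _ hz, h.map_delta _ hz, hTh] at hcut'
    have hmono := h.strictMono hT hz (sub_one_lt (AffineMap.lineMap c d s : ℝ))
    have hmem : (u (AffineMap.lineMap x y s),
        max (AffineMap.lineMap (v x c) (v y d) σ)
          (v (AffineMap.lineMap x y s) (AffineMap.lineMap c d s - 1))) ∈
        (delta hK₂ (u (AffineMap.lineMap x y s))
          (v (AffineMap.lineMap x y s) (AffineMap.lineMap c d s))).epi := by
      rw [hcut']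
      refine ⟨(mem_epi_hull (h.mem x hx) (h.mem y hy)).2 ⟨σ, hσ, h2, le_max_left _ _⟩, ?_⟩
      exact mem_epi_delta.2 ⟨h.mem _ hz, rfl, le_max_right _ _⟩
    have := (mem_epi_delta.1 hmem).2.2
    simp only at this
    exact absurd this (not_le.2 (max_lt hlt hmono))
  obtain ⟨σ, hσ, h1, -⟩ := key 0 0
  refine ⟨σ, hσ, h1, fun c d => ?_⟩
  obtain ⟨σ', -, h1', h2'⟩ := key c d
  have hne : u x ≠ u y := fun hu => hxy (h.injOn hT hx hy hu)
  have : σ' = σ := AffineMap.lineMap_injective ℝ hne (h1'.symm.trans h1)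
  rw [h2', this]

end IsPointMap

end IsSupInfEmbedding

/-! ### Affine dependence on the height and linear extension -/

/-- The monotone solutions of the Pexider equation for weighted means are affine. -/
theorem Monotone.exists_eq_mul_add_of_lineMap {f g h : ℝ → ℝ} (hg : Monotone g) {s σ : ℝ}
    (hs : s ≠ 0) (hσ : σ ≠ 1)
    (H : ∀ c d, f (AffineMap.lineMap c d s) = AffineMap.lineMap (g c) (h d) σ) :
    ∃ a b, ∀ c, g c = a * c + b := by
  simp only [AffineMap.lineMap_apply_ring] at H
  have hadd : ∀ c c', g (c + c') - g 0 = (g c - g 0) + (g c' - g 0) := by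
    intro c c'
    have e1 := H (c + c') 0
    have e2 := H c ((1 - s) * c' / s)
    have e3 := H c' 0
    have e4 := H 0 ((1 - s) * c' / s)
    rw [mul_div_cancel₀ _ hs] at e2 e4
    rw [show (1 - s) * (c + c') + s * 0 = (1 - s) * c + (1 - s) * c' by ring, e2] at e1
    rw [show (1 - s) * 0 + (1 - s) * c' = (1 - s) * c' + s * 0 by ring, e3] at e4
    have hσ' : 1 - σ ≠ 0 := sub_ne_zero.2 hσ.symm
    apply mul_left_cancel₀ hσ'
    linear_combination -e1 - e4
  let k : ℝ →+ ℝ := AddMonoidHom.mk' (fun c => g c - g 0) hadd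
  have hk : Continuous k := by
    refine MeasureTheory.Measure.AddMonoidHom.continuous_of_measurable k ?_
    have : Monotone k := fun c d hcd => sub_le_sub_right (hg hcd) _
    exact this.measurable
  refine ⟨k 1, g 0, fun c => ?_⟩
  have h1 : k c = c * k 1 := by
    have := map_real_smul k hk c 1
    simpa using this
  have h2 : k c = g c - g 0 := rfl
  linarith

/-- A map that is affine along the segments of a convex body extends to a linear map in homogeneous
coordinates. -/
theorem Convex.exists_linearMap_apply_one {E W : Type*} [NormedAddCommGroup E] [NormedSpace ℝ E]
    [FiniteDimensional ℝ E] [AddCommGroup W] [Module ℝ W] {K : Set E} (hK : Convex ℝ K)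
    (hint : (interior K).Nonempty) (φ : E → W)
    (hφ : ∀ x ∈ K, ∀ y ∈ K, ∀ s ∈ Set.Icc (0 : ℝ) 1,
      φ (AffineMap.lineMap x y s) = AffineMap.lineMap (φ x) (φ y) s) :
    ∃ Λ : E × ℝ →ₗ[ℝ] W, ∀ x ∈ K, Λ (x, 1) = φ x := by
  obtain ⟨x₀, hx₀⟩ : K.Nonempty := hint.mono interior_subset
  obtain ⟨b, hb⟩ := exists_basis_add_mem hint hx₀
  let M : E →ₗ[ℝ] W := b.constr ℝ fun i => φ (x₀ + b i) - φ x₀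
  let ψ : E → W := fun x => φ x - (M x + (φ x₀ - M x₀))
  have hψ : ∀ x ∈ K, ∀ y ∈ K, ∀ s ∈ Set.Icc (0 : ℝ) 1,
      ψ (AffineMap.lineMap x y s) = AffineMap.lineMap (ψ x) (ψ y) s := by
    intro x hx y hy s hs
    simp only [ψ]
    rw [hφ x hx y hy s hs]
    simp only [AffineMap.lineMap_apply_module, map_add, map_smul]
    module
  -- The difference `ψ` vanishes on a simplex with vertices in `K`, and then on all of `K`.
  let Z : Set E := {x | x ∈ K ∧ ψ x = 0}
  have hZ : Convex ℝ Z := by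
    rw [convex_iff_segment_subset]
    rintro x ⟨hx, hx0⟩ y ⟨hy, hy0⟩ z hz
    rw [segment_eq_image_lineMap] at hz
    obtain ⟨s, hs, rfl⟩ := hz
    refine ⟨hK.lineMap_mem hx hy hs, ?_⟩
    rw [hψ x hx y hy s hs, hx0, hy0, AffineMap.lineMap_same_apply]
  have hZ0 : x₀ ∈ Z := ⟨hx₀, by simp [ψ]⟩
  have hZb : ∀ i, x₀ + b i ∈ Z := fun i => ⟨hb i, by
    have hM : M (b i) = φ (x₀ + b i) - φ x₀ := b.constr_basis ℝ _ i
    simp only [ψ, map_add, hM]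
    abel⟩
  have hZint : (interior Z).Nonempty := by
    rw [hZ.interior_nonempty_iff_affineSpan_eq_top,
      AffineSubspace.affineSpan_eq_top_iff_vectorSpan_eq_top_of_nonempty ℝ E E ⟨x₀, hZ0⟩,
      eq_top_iff, ← b.span_eq, Submodule.span_le]
    rintro _ ⟨i, rfl⟩
    simpa using vsub_mem_vectorSpan ℝ (hZb i) hZ0
  obtain ⟨z, hz⟩ := hZint
  refine ⟨M.comp (LinearMap.fst ℝ E ℝ) + (LinearMap.snd ℝ E ℝ).smulRight (φ x₀ - M x₀),
    fun x hx => ?_⟩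
  have hψx : ψ x = 0 := by
    have hc : Filter.Tendsto (fun ε : ℝ => AffineMap.lineMap z x (-ε) : ℝ → E)
        (nhdsWithin 0 (Set.Ioi 0)) (nhds z) := by
      have h1 : Continuous fun ε : ℝ => (AffineMap.lineMap z x (-ε) : E) := by
        have : Continuous fun r : ℝ => (AffineMap.lineMap z x r : E) :=
          AffineMap.lineMap_continuous
        exact this.comp continuous_neg
      have h2 := h1.tendsto 0
      simp only [neg_zero, AffineMap.lineMap_apply_zero] at h2
      exact h2.mono_left nhdsWithin_le_nhds
    obtain ⟨ε, hεZ, hε⟩ := ((hc.eventually (mem_interior_iff_mem_nhds.1 hz)).and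
      self_mem_nhdsWithin).exists
    have hε0 : (0 : ℝ) < ε := hε
    have hpos : 0 < 1 + ε := by linarith
    -- `z` lies between `x` and a point of `Z` slightly beyond `z`.
    have hs : ε / (1 + ε) ∈ Set.Icc (0 : ℝ) 1 :=
      ⟨by positivity, by rw [div_le_one hpos]; linarith⟩
    have hzε : AffineMap.lineMap (AffineMap.lineMap z x (-ε) : E) x (ε / (1 + ε)) = z := by
      simp only [AffineMap.lineMap_apply_module]
      match_scalars <;> field_simp <;> ring
    have h3 := hψ _ hεZ.1 x hx _ hs
    rw [hzε, hεZ.2, (interior_subset hz : z ∈ Z).2, AffineMap.lineMap_apply_module, smul_zero,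
      zero_add, eq_comm, smul_eq_zero] at h3
    exact h3.resolve_left (by positivity)
  have := sub_eq_zero.1 hψx
  simp [this]

namespace IsSupInfEmbedding.IsPointMap

open Cvx

variable {E : Type*} [NormedAddCommGroup E] [NormedSpace ℝ E]
  {K₁ K₂ : Set E} {hK₁ : Convex ℝ K₁} {hK₂ : Convex ℝ K₂} {T : Cvx K₁ → Cvx K₂}
  {u : E → E} {v : E → ℝ → ℝ}

theorem exists_affine_height (hT : IsSupInfEmbedding hK₁ hK₂ T) (h : IsPointMap hK₁ hK₂ T u v)
    (hK : K₁.Nontrivial) :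
    ∃ a b : E → ℝ, ∀ x ∈ K₁, 0 < a x ∧ ∀ c, v x c = a x * c + b x := by
  have key : ∀ x, ∃ a b : ℝ, x ∈ K₁ → 0 < a ∧ ∀ c, v x c = a * c + b := by
    intro x
    by_cases hx : x ∈ K₁
    · obtain ⟨y, hy, hyx⟩ := hK.exists_ne x
      have hhalf : (1 / 2 : ℝ) ∈ Set.Icc (0 : ℝ) 1 := by norm_num
      obtain ⟨σ, -, h1, h2⟩ := h.exists_lineMap_eq hT hx hy hyx.symm hhalf
      have hσ : σ ≠ 1 := by
        rintro rfl
        rw [AffineMap.lineMap_apply_one] at h1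
        have h3 := h.injOn hT (hK₁.lineMap_mem hx hy hhalf) hy h1
        rw [AffineMap.lineMap_eq_right_iff] at h3
        rcases h3 with h3 | h3
        · exact hyx h3.symm
        · norm_num at h3
      have hmono := h.strictMono hT hx
      obtain ⟨a, b, hab⟩ := hmono.monotone.exists_eq_mul_add_of_lineMap (by norm_num)
        hσ h2
      refine ⟨a, b, fun _ => ⟨?_, hab⟩⟩
      have := hmono zero_lt_one
      rw [hab, hab] at this
      linarith
    · exact ⟨0, 0, fun h => absurd h hx⟩
  choose a b hab using key
  exact ⟨a, b, hab⟩

/-- With the weight `w = 1 / a`, the functions `w`, `w • u` and `w * b` are affine on segments. -/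
theorem weighted_lineMap (hT : IsSupInfEmbedding hK₁ hK₂ T) (h : IsPointMap hK₁ hK₂ T u v)
    {a b : E → ℝ} (hab : ∀ x ∈ K₁, 0 < a x ∧ ∀ c, v x c = a x * c + b x)
    {x y : E} (hx : x ∈ K₁) (hy : y ∈ K₁) {s : ℝ} (hs : s ∈ Set.Icc (0 : ℝ) 1) :
    (a (AffineMap.lineMap x y s))⁻¹ = AffineMap.lineMap (a x)⁻¹ (a y)⁻¹ s ∧
    (a (AffineMap.lineMap x y s))⁻¹ • u (AffineMap.lineMap x y s) =
      AffineMap.lineMap ((a x)⁻¹ • u x) ((a y)⁻¹ • u y) s ∧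
    (a (AffineMap.lineMap x y s))⁻¹ * b (AffineMap.lineMap x y s) =
      AffineMap.lineMap ((a x)⁻¹ * b x) ((a y)⁻¹ * b y) s := by
  rcases eq_or_ne x y with rfl | hxy
  · simp
  obtain ⟨σ, -, h1, h2⟩ := h.exists_lineMap_eq hT hx hy hxy hs
  obtain ⟨hax, hvx⟩ := hab x hx
  obtain ⟨hay, hvy⟩ := hab y hy
  obtain ⟨haz, hvz⟩ := hab _ (hK₁.lineMap_mem hx hy hs)
  rw [h1]
  simp only [hvx, hvy, hvz] at h2
  generalize AffineMap.lineMap x y s = z at *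
  simp only [AffineMap.lineMap_apply_ring] at h2
  have e0 := h2 0 0
  have e1 := h2 1 0
  have e2 := h2 0 1
  have hs1 : (1 - s) * (a x)⁻¹ = (a z)⁻¹ * (1 - σ) := by
    field_simp
    linarith
  have hs2 : s * (a y)⁻¹ = (a z)⁻¹ * σ := by
    field_simp
    linarith
  refine ⟨?_, ?_, ?_⟩
  · rw [AffineMap.lineMap_apply_ring, hs1, hs2]
    ring
  · rw [AffineMap.lineMap_apply_module, AffineMap.lineMap_apply_module, smul_smul, smul_smul, hs1,
      hs2, smul_add, smul_smul, smul_smul]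
  · rw [AffineMap.lineMap_apply_ring, ← mul_assoc, ← mul_assoc, hs1, hs2]
    linear_combination (a z)⁻¹ * e0

/-- In homogeneous coordinates the point map is an invertible linear map. -/
theorem exists_linearEquiv [FiniteDimensional ℝ E] (hT : IsSupInfEmbedding hK₁ hK₂ T)
    (h : IsPointMap hK₁ hK₂ T u v) (hint : (interior K₁).Nonempty) {a b : E → ℝ}
    (hab : ∀ x ∈ K₁, 0 < a x ∧ ∀ c, v x c = a x * c + b x) :
    ∃ L : ((E × ℝ) × ℝ) ≃ₗ[ℝ] ((E × ℝ) × ℝ), ∀ p : E × ℝ, p.1 ∈ K₁ →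
      0 < (L (p, 1)).2 ∧ ((L (p, 1)).2)⁻¹ • (L (p, 1)).1 = (u p.1, v p.1 p.2) := by
  obtain ⟨W, hW⟩ := hK₁.exists_linearMap_apply_one hint (fun x => (a x)⁻¹)
    fun x hx y hy s hs => (h.weighted_lineMap hT hab hx hy hs).1
  obtain ⟨U, hU⟩ := hK₁.exists_linearMap_apply_one hint (fun x => (a x)⁻¹ • u x)
    fun x hx y hy s hs => (h.weighted_lineMap hT hab hx hy hs).2.1
  obtain ⟨B, hB⟩ := hK₁.exists_linearMap_apply_one hint (fun x => (a x)⁻¹ * b x)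
    fun x hx y hy s hs => (h.weighted_lineMap hT hab hx hy hs).2.2
  let π : ((E × ℝ) × ℝ) →ₗ[ℝ] E × ℝ :=
    ((LinearMap.fst ℝ E ℝ).comp (LinearMap.fst ℝ (E × ℝ) ℝ)).prod (LinearMap.snd ℝ (E × ℝ) ℝ)
  let L₀ : ((E × ℝ) × ℝ) →ₗ[ℝ] ((E × ℝ) × ℝ) :=
    ((U.comp π).prod ((LinearMap.snd ℝ E ℝ).comp (LinearMap.fst ℝ (E × ℝ) ℝ) + B.comp π)).prod
      (W.comp π)
  have hL₀ : ∀ x t z, L₀ ((x, t), z) = ((U (x, z), t + B (x, z)), W (x, z)) :=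
    fun x t z => rfl
  have hinj : Function.Injective L₀ := by
    rw [injective_iff_map_eq_zero]
    rintro ⟨⟨x, t⟩, z⟩ h0
    rw [hL₀] at h0
    simp only [Prod.mk_eq_zero] at h0
    obtain ⟨⟨hU0, hB0⟩, hW0⟩ := h0
    obtain ⟨y, hy⟩ := hint
    have hyK : y ∈ K₁ := interior_subset hy
    -- A kernel direction would move an interior point `y` of `K₁` without changing its image.
    have hc : Filter.Tendsto (fun ε : ℝ => (1 + ε * z)⁻¹ • (y + ε • x))
        (nhdsWithin 0 {0}ᶜ) (nhds y) := by
      have h1 : ContinuousAt (fun ε : ℝ => (1 + ε * z)⁻¹ • (y + ε • x)) 0 := by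
        refine ContinuousAt.smul (ContinuousAt.inv₀ (by fun_prop) (by simp)) (by fun_prop)
      have h2 := h1.tendsto
      simp only [zero_mul, add_zero, inv_one, zero_smul, one_smul] at h2
      exact h2.mono_left nhdsWithin_le_nhds
    have hd : ∀ᶠ ε : ℝ in nhdsWithin 0 {0}ᶜ, 1 + ε * z ≠ 0 := by
      have h1 : ContinuousAt (fun ε : ℝ => 1 + ε * z) 0 := by fun_prop
      exact (h1.eventually_ne (by simp)).filter_mono nhdsWithin_le_nhds
    obtain ⟨ε, ⟨hεK, hεd⟩, hε⟩ := ((hc.eventually (mem_interior_iff_mem_nhds.1 hy)).and hd |>.and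
      self_mem_nhdsWithin).exists
    have hε0 : ε ≠ 0 := hε
    have hpt : ((1 + ε * z)⁻¹ • (y + ε • x), (1 : ℝ)) =
        (1 + ε * z)⁻¹ • ((y, (1 : ℝ)) + ε • (x, z)) := by
      simp [hεd]
    have hW' : (a ((1 + ε * z)⁻¹ • (y + ε • x)))⁻¹ = (1 + ε * z)⁻¹ * (a y)⁻¹ := by
      rw [← hW _ hεK, hpt, map_smul, map_add, map_smul, hW0, hW _ hyK]
      simp
    have hU' : (a ((1 + ε * z)⁻¹ • (y + ε • x)))⁻¹ • u ((1 + ε * z)⁻¹ • (y + ε • x)) =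
        (1 + ε * z)⁻¹ • (a y)⁻¹ • u y := by
      rw [← hU _ hεK, hpt, map_smul, map_add, map_smul, hU0, hU _ hyK]
      simp
    have hay : (a y)⁻¹ ≠ 0 := (inv_pos.2 (hab y hyK).1).ne'
    rw [hW', mul_smul] at hU'
    have hu := smul_right_injective E hay (smul_right_injective E (inv_ne_zero hεd) hU')
    have hyy := h.injOn hT hεK hyK hu
    have hxy : x = z • y := by
      rw [inv_smul_eq_iff₀ hεd, add_smul, one_smul, add_right_inj, mul_smul] at hyy
      exact smul_right_injective E hε0 hyy
    have hz : z = 0 := by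
      have h1 : (x, z) = z • (y, (1 : ℝ)) := by simp [hxy]
      rw [h1, map_smul, hW _ hyK, smul_eq_mul, mul_eq_zero] at hW0
      exact hW0.resolve_right hay
    have hx : x = 0 := by rw [hxy, hz, zero_smul]
    subst hz hx
    have h00 : ((0 : E), (0 : ℝ)) = 0 := rfl
    rw [h00, map_zero, add_zero] at hB0
    rw [hB0]
    rfl
  refine ⟨LinearEquiv.ofInjectiveEndo L₀ hinj, ?_⟩
  rintro ⟨x, c⟩ hx
  simp only at hx
  obtain ⟨hax, hvx⟩ := hab x hx
  rw [LinearEquiv.coe_ofInjectiveEndo, hL₀, hW x hx, hU x hx, hB x hx]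
  refine ⟨inv_pos.2 hax, ?_⟩
  rw [Prod.ext_iff]
  constructor
  · simp [smul_smul, hax.ne']
  · simp only [Prod.smul_snd, smul_eq_mul, inv_inv, hvx]
    field_simp

end IsSupInfEmbedding.IsPointMap

/-! ### Images of epigraphs -/

/-- A projective map sends convex sets on which its denominator is positive to convex sets. -/
theorem LinearMap.convex_image_inv_smul {V : Type*} [AddCommGroup V] [Module ℝ V]
    (L : V × ℝ →ₗ[ℝ] V × ℝ) {A : Set V} (hA : Convex ℝ A) (hpos : ∀ p ∈ A, 0 < (L (p, 1)).2) :
    Convex ℝ ((fun p => ((L (p, 1)).2)⁻¹ • (L (p, 1)).1) '' A) := by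
  rintro _ ⟨p, hp, rfl⟩ _ ⟨q, hq, rfl⟩ α β hα hβ hαβ
  have hp0 := hpos p hp
  have hq0 := hpos q hq
  -- The weights of the preimage are `α` and `β` divided by the denominators, and normalized.
  have hα' : 0 ≤ α / (L (p, 1)).2 := by positivity
  have hβ' : 0 ≤ β / (L (q, 1)).2 := by positivity
  have hm : 0 < α / (L (p, 1)).2 + β / (L (q, 1)).2 := by
    rcases hα.eq_or_lt with h | h
    · have : 0 < β := by linarith
      positivity
    · positivity
  set m := α / (L (p, 1)).2 + β / (L (q, 1)).2 with hm_def
  have hmem := hA hp hq (div_nonneg hα' hm.le) (div_nonneg hβ' hm.le)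
    (by rw [← add_div, ← hm_def, div_self hm.ne'])
  refine ⟨_, hmem, ?_⟩
  have hsplit : ((α / (L (p, 1)).2 / m) • p + (β / (L (q, 1)).2 / m) • q, (1 : ℝ)) =
      m⁻¹ • ((α / (L (p, 1)).2) • (p, (1 : ℝ)) + (β / (L (q, 1)).2) • (q, (1 : ℝ))) := by
    rw [Prod.ext_iff]
    constructor
    · simp only [Prod.smul_fst, Prod.fst_add, smul_add, smul_smul]
      congr 2 <;> ring
    · simp only [Prod.smul_snd, Prod.snd_add, smul_eq_mul, mul_one]
      rw [← hm_def, inv_mul_cancel₀ hm.ne']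
  have h2 : (L ((α / (L (p, 1)).2 / m) • p + (β / (L (q, 1)).2 / m) • q, (1 : ℝ))).2 = m⁻¹ := by
    rw [hsplit, map_smul, map_add, map_smul, map_smul]
    simp only [Prod.smul_snd, Prod.snd_add, smul_eq_mul]
    rw [div_mul_cancel₀ _ hp0.ne', div_mul_cancel₀ _ hq0.ne', hαβ, mul_one]
  simp only
  rw [h2, hsplit, map_smul, map_add, map_smul, map_smul]
  simp only [Prod.smul_fst, Prod.fst_add, smul_smul, div_eq_mul_inv, inv_inv]
  rw [mul_inv_cancel₀ hm.ne', one_smul]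

namespace IsSupInfEmbedding.IsPointMap

open Cvx

variable {E : Type*} [NormedAddCommGroup E] [NormedSpace ℝ E]
  {K₁ K₂ : Set E} {hK₁ : Convex ℝ K₁} {hK₂ : Convex ℝ K₂} {T : Cvx K₁ → Cvx K₂}
  {u : E → E} {v : E → ℝ → ℝ}

theorem map_negInf (hT : IsSupInfEmbedding hK₁ hK₂ T) (h : IsPointMap hK₁ hK₂ T u v)
    (hsurj : ∀ x ∈ K₁, Function.Surjective (v x)) (hne : K₁.Nonempty) :
    T (negInf hK₁) = negInf hK₂ := by
  obtain ⟨x, hx⟩ := hne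
  refine eq_negInf_of_line (h.mem x hx) fun t => ?_
  obtain ⟨c, rfl⟩ := hsurj x hx t
  exact (h.mem_epi_map_iff hT hx).2 ⟨hx, bot_le⟩

/-- As `f` is the generalized infimum of the functions `delta x c` with `(x, c)` in its epigraph, the
epigraph of `T f` is no larger than the closure of the image of `f.epi` under the point map. -/
theorem epi_map_subset_closure (hT : IsSupInfEmbedding hK₁ hK₂ T)
    (h : IsPointMap hK₁ hK₂ T u v) (hsurj : ∀ x ∈ K₁, Function.Surjective (v x))
    (hK : K₁.Nontrivial) {f : Cvx K₁} (hf : f ≠ negInf hK₁)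
    (hconv : Convex ℝ ((fun p : E × ℝ => (u p.1, v p.1 p.2)) '' f.epi)) :
    (T f).epi ⊆ closure ((fun p : E × ℝ => (u p.1, v p.1 p.2)) '' f.epi) := by
  rcases f.epi.eq_empty_or_nonempty with hemp | hne
  · rw [eq_of_epi_eq_empty hemp (epi_posInf hK₁), h.epi_map_posInf hT hK]
    exact Set.empty_subset _
  let S : Set (Cvx K₁) := (fun p : E × ℝ => delta hK₁ p.1 p.2) '' f.epi
  have hS : S.Nonempty := hne.image _
  have hfS : f = infHat hK₁ S := (isGLB_deltas f).unique (isGLB_infHat hK₁ S)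
  have hunion : ⋃ g ∈ T '' S, g.epi = (fun p : E × ℝ => (u p.1, v p.1 p.2)) '' f.epi := by
    ext ⟨y, t⟩
    simp only [S, Set.mem_iUnion, Set.mem_image, exists_prop]
    constructor
    · rintro ⟨_, ⟨_, ⟨⟨x, c⟩, hp, rfl⟩, rfl⟩, hy⟩
      have hx : x ∈ K₁ := hp.1
      simp only [h.map_delta x hx] at hy
      obtain ⟨-, rfl, h2⟩ := mem_epi_delta.1 hy |>.imp_right fun h => h.imp_left Eq.symm
      obtain ⟨c', rfl⟩ := hsurj x hx t
      exact ⟨(x, c'), mem_epi_of_le hp ((h.strictMono hT hx).le_iff_le.1 h2), rfl⟩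
    · rintro ⟨⟨x, c⟩, hp, heq⟩
      have hx : x ∈ K₁ := hp.1
      refine ⟨_, ⟨_, ⟨(x, c), hp, rfl⟩, rfl⟩, ?_⟩
      rw [← heq, h.map_delta x hx]
      exact mem_epi_delta.2 ⟨h.mem x hx, rfl, le_rfl⟩
  have hTf := hT.map_ne_negInf hf
  rw [hfS, hT.map_infHat S hS] at hTf
  have := epi_infHat_subset_closure hK₂ hTf (by rwa [hunion])
  rwa [← hT.map_infHat S hS, ← hfS, hunion] at this

/-- The restriction of `f` to the preimage under `u` of a closed convex set. -/
theorem exists_epi_eq_inter_preimage (hT : IsSupInfEmbedding hK₁ hK₂ T)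
    (h : IsPointMap hK₁ hK₂ T u v) (hu : ContinuousOn u K₁) {f : Cvx K₁} (hf : f ≠ negInf hK₁)
    {B : Set E} (hB : Convex ℝ B) (hB' : IsClosed B) :
    ∃ g : Cvx K₁, g.epi = f.epi ∩ {p | u p.1 ∈ B} := by
  refine ⟨ofEpi hK₁ (f.epi ∩ {p | u p.1 ∈ B}) ?_ ?_ ?_ ?_, ?_⟩
  · rw [convex_iff_segment_subset]
    rintro p ⟨hp, hpB⟩ q ⟨hq, hqB⟩ r hr
    refine ⟨f.convex_epi.segment_subset hp hq hr, ?_⟩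
    rw [segment_eq_image_lineMap] at hr
    obtain ⟨s, hs, rfl⟩ := hr
    have hfst : (AffineMap.lineMap p q s).1 = AffineMap.lineMap p.1 q.1 s := by
      simp [AffineMap.lineMap_apply]
    change u (AffineMap.lineMap p q s).1 ∈ B
    rw [hfst]
    rcases eq_or_ne p.1 q.1 with hpq | hpq
    · rwa [hpq, AffineMap.lineMap_same_apply]
    · obtain ⟨σ, hσ, h1, -⟩ := h.exists_lineMap_eq hT hp.1 hq.1 hpq hs
      rw [h1]
      exact hB.lineMap_mem hpB hqB hσ
  · intro p hp hpK
    refine ⟨mem_epi_of_mem_closure (closure_mono Set.inter_subset_left hp) hpK, ?_⟩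
    have h1 : p.1 ∈ closure {x | x ∈ K₁ ∧ u x ∈ B} :=
      map_mem_closure continuous_fst hp fun q hq => ⟨hq.1.1, hq.2⟩
    have h2 : ContinuousWithinAt u {x | x ∈ K₁ ∧ u x ∈ B} p.1 :=
      (hu p.1 hpK).mono fun x hx => hx.1
    have h3 := h2.mem_closure h1 (fun x hx => hx.2 : Set.MapsTo u _ B)
    rwa [hB'.closure_eq] at h3
  · exact fun x s t hx hst => ⟨mem_epi_of_le hx.1 hst, hx.2⟩
  · intro x hx
    by_contra hcon
    push Not at hcon
    exact hf (eq_negInf_of_line hx fun t => (hcon t).1)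
  · ext p
    exact ⟨fun h => (mem_epi_ofEpi.1 h).2, fun h => mem_epi_ofEpi.2 ⟨h.1.1, h⟩⟩

/-- Outside the range of `u` the image of `f` is `+∞`: cutting `f` down to preimages of small balls
around such a point `y` does not change the closed hull near `y`, although these cuts have
supremum `+∞`. -/
theorem notMem_epi_map (hT : IsSupInfEmbedding hK₁ hK₂ T) (h : IsPointMap hK₁ hK₂ T u v)
    (hsurj : ∀ x ∈ K₁, Function.Surjective (v x)) (hu : ContinuousOn u K₁) (hK : K₁.Nontrivial)
    {f : Cvx K₁} (hf : f ≠ negInf hK₁)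
    (hconv : Convex ℝ ((fun p : E × ℝ => (u p.1, v p.1 p.2)) '' f.epi)) {y : E}
    (hy : y ∉ u '' K₁) (t : ℝ) : (y, t) ∉ (T f).epi := by
  intro hyt
  choose g hg using fun m : ℕ => h.exists_epi_eq_inter_preimage hT hu hf
    (convex_closedBall y (1 / ((m : ℝ) + 1))) Metric.isClosed_closedBall
  have hinter : (posInf hK₁).epi = ⋂ k ∈ Set.range g, k.epi := by
    rw [epi_posInf, eq_comm, Set.biInter_range, Set.eq_empty_iff_forall_notMem]
    intro p hp
    rw [Set.mem_iInter] at hp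
    simp only [hg] at hp
    refine hy ⟨p.1, (hp 0).1.1, ?_⟩
    rw [← dist_le_zero]
    exact ge_of_tendsto' (tendsto_one_div_add_atTop_nhds_zero_nat (𝕜 := ℝ)) fun m => (hp m).2
  have hTinter := hT.epi_map_of_epi_eq_biInter (Set.range_nonempty g) hinter
  rw [h.epi_map_posInf hT hK, Set.biInter_range, eq_comm,
    Set.eq_empty_iff_forall_notMem] at hTinter
  apply hTinter (y, t)
  rw [Set.mem_iInter]
  intro m
  refine mem_epi_of_mem_closure ?_ hyt.1
  have hcl := h.epi_map_subset_closure hT hsurj hK hf hconv hyt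
  have hopen : IsOpen {q : E × ℝ | q.1 ∈ Metric.ball y (1 / ((m : ℝ) + 1))} :=
    Metric.isOpen_ball.preimage continuous_fst
  have hmem : (y, t) ∈ {q : E × ℝ | q.1 ∈ Metric.ball y (1 / ((m : ℝ) + 1))} :=
    Metric.mem_ball_self Nat.one_div_pos_of_nat
  refine closure_mono ?_ (hopen.inter_closure ⟨hmem, hcl⟩)
  rintro _ ⟨hq, ⟨x, c⟩, hp, rfl⟩
  refine (h.mem_epi_map_iff hT hp.1).2 ?_
  rw [hg m]
  exact ⟨hp, Metric.ball_subset_closedBall hq⟩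

end IsSupInfEmbedding.IsPointMap

theorem theorem4p3 (n : ℕ) (hn : 1 ≤ n) (K₁ K₂ : Set (EuclideanSpace ℝ (Fin n)))
    (hK₁ : Convex ℝ K₁) (hK₂ : Convex ℝ K₂)
    (hint₁ : (interior K₁).Nonempty) (hint₂ : (interior K₂).Nonempty)
    (T : Cvx K₁ → Cvx K₂) (hT : Function.Injective T)
    (hsup : ∀ S : Set (Cvx K₁), S.Nonempty →
      T (Cvx.sup hK₁ S) = Cvx.sup hK₂ (T '' S))
    (hinf : ∀ S : Set (Cvx K₁), S.Nonempty →
      T (Cvx.infHat hK₁ S) = Cvx.infHat hK₂ (T '' S)) :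
    ∃ K₂' : Set (EuclideanSpace ℝ (Fin n)), K₂' ⊆ K₂ ∧
      ∃ F : EuclideanSpace ℝ (Fin n) × ℝ → EuclideanSpace ℝ (Fin n) × ℝ,
        IsFractionalLinearOn F (K₁ ×ˢ Set.univ) ∧
        Set.BijOn F (K₁ ×ˢ Set.univ) (K₂' ×ˢ Set.univ) ∧
        (∀ f : Cvx K₁, f ≠ Cvx.negInf hK₁ →
          (T f).epi = F '' f.epi ∧ ∀ x : K₂, (x : EuclideanSpace ℝ (Fin n)) ∉ K₂' →
            (T f).toFun x = ⊤) ∧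
        T (Cvx.negInf hK₁) = Cvx.negInf hK₂ := by
  have hE : IsSupInfEmbedding hK₁ hK₂ T := ⟨hT, hsup, hinf⟩
  have hK : K₁.Nontrivial := by
    have : Nonempty (Fin n) := ⟨⟨0, hn⟩⟩
    rw [← Set.not_subsingleton_iff]
    intro hsub
    rcases hsub.eq_empty_or_singleton with h | ⟨x, h⟩
    · simp [h] at hint₁
    · simp [h, interior_singleton] at hint₁
  obtain ⟨u, v, h⟩ := hE.exists_isPointMap hint₁
  obtain ⟨a, b, hab⟩ := h.exists_affine_height hE hK
  obtain ⟨L, hL⟩ := h.exists_linearEquiv hE hint₁ hab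
  have hsurj : ∀ x ∈ K₁, Function.Surjective (v x) := by
    intro x hx t
    obtain ⟨hax, hvx⟩ := hab x hx
    refine ⟨(t - b x) / a x, ?_⟩
    rw [hvx, mul_div_cancel₀ _ hax.ne', sub_add_cancel]
  have hu : ContinuousOn u K₁ := by
    have hLc : Continuous L := L.toLinearMap.continuous_of_finiteDimensional
    have hd : ContinuousOn (fun x => ((L ((x, 0), 1)).2)⁻¹) K₁ :=
      ContinuousOn.inv₀ (by fun_prop) fun x hx => (hL (x, 0) hx).1.ne'
    have hc : ContinuousOn (fun x => ((L ((x, 0), 1)).2)⁻¹ • (L ((x, 0), 1)).1.1) K₁ :=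
      hd.smul (by fun_prop)
    exact hc.congr fun x hx => (congrArg Prod.fst (hL (x, 0) hx).2).symm
  have hconv : ∀ f : Cvx K₁,
      Convex ℝ ((fun p : EuclideanSpace ℝ (Fin n) × ℝ => (u p.1, v p.1 p.2)) '' f.epi) := by
    intro f
    have himg : (fun p : EuclideanSpace ℝ (Fin n) × ℝ => (u p.1, v p.1 p.2)) '' f.epi =
        (fun p => ((L (p, 1)).2)⁻¹ • (L (p, 1)).1) '' f.epi :=
      Set.image_congr fun p (hp : p ∈ f.epi) => (hL p hp.1).2.symm
    rw [himg]
    exact L.toLinearMap.convex_image_inv_smul f.convex_epi fun p hp =>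
      (hL p (Cvx.fst_mem_of_mem_epi hp)).1
  refine ⟨u '' K₁, Set.image_subset_iff.2 h.mem, fun p => (u p.1, v p.1 p.2),
    ⟨L, fun p hp => ⟨(hL p hp.1).1.ne', (hL p hp.1).2.symm⟩⟩, ⟨?_, ?_, ?_⟩, ?_,
    h.map_negInf hE hsurj hK.nonempty⟩
  · exact fun p hp => ⟨⟨p.1, hp.1, rfl⟩, trivial⟩
  · rintro ⟨x, c⟩ ⟨hx, -⟩ ⟨y, d⟩ ⟨hy, -⟩ hxy
    obtain ⟨h1, h2⟩ := Prod.ext_iff.1 hxy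
    obtain rfl := h.injOn hE hx hy h1
    exact Prod.ext rfl ((h.strictMono hE hx).injective h2)
  · rintro ⟨_, t⟩ ⟨⟨x, hx, rfl⟩, -⟩
    obtain ⟨c, rfl⟩ := hsurj x hx t
    exact ⟨(x, c), ⟨hx, trivial⟩, rfl⟩
  · intro f hf
    have hout : ∀ y ∉ u '' K₁, ∀ t, (y, t) ∉ (T f).epi := fun y hy t =>
      h.notMem_epi_map hE hsurj hu hK hf (hconv f) hy t
    refine ⟨Set.Subset.antisymm ?_ ?_, fun x hx => Cvx.toFun_eq_top_of_notMem (hout x hx)⟩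
    · rintro ⟨y, t⟩ hyt
      by_cases hy : y ∈ u '' K₁
      · obtain ⟨x, hx, rfl⟩ := hy
        obtain ⟨c, rfl⟩ := hsurj x hx t
        exact ⟨(x, c), (h.mem_epi_map_iff hE hx).1 hyt, rfl⟩
      · exact absurd hyt (hout y hy t)
    · rintro _ ⟨p, hp, rfl⟩
      exact (h.mem_epi_map_iff hE hp.1).2 hp
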